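/- A prefix machine is a partial computable function $D(p,n)$ of a binary string $p$ (the program) and a natural number $n$ (the condition), with values in binary strings, such that for every $n$ no program in the set $\{p : D(p,n)\text{ is defined}\}$ is a proper prefix of another. Put $K_D(x|n)=\min\{|p| : D(p,n)=x\}$ (with $\min\emptyset=\infty$). A prefix machine $U$ is optimal if for every prefix machine $D$ there is a constant $c$ with $K_U(x|n)\le K_D(x|n)+c$ for all $x$ and $n$. Unconditional prefix machines with oracle $\mathbf{0}'$, their complexity and optimality are defined in the same way, with functions $D(p)$ that are partial computable relative to $\mathbf{0}'$ (the universal enumerable set $\{\langle e,k\rangle : \varphi_e(k)\text{ is defined}\}$) and with no condition. Optimal machines of both kinds exist. Fix any optimal prefix machine $U$ and any optimal unconditional prefix machine $V$ with oracle $\mathbf{0}'$, and let $K(x|n)=K_U(x|n)$ and $K^{\mathbf{0}'}(x)=K_V(x)$. Then $$\limsup_{n\to\infty} K(x|n)=K^{\mathbf{0}'}(x)+O(1),$$ that is, there is a constant $c$, depending only on $U$ and $V$, such that for every binary string $x$ $$\limsup_{n\to\infty} K(x|n)\le K^{\mathbf{0}'}(x)+c\quad\text{and}\quad K^{\mathbf{0}'}(x)\le\limsup_{n\to\infty}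 K(x|n)+c.$$ -/

import Mathlib

namespace LimitComplexity

/-- The characteristic function of the universal enumerable set
`{⟨e, k⟩ | the e-th partial recursive function is defined at k}`, as an oracle. -/
noncomputable def zeroJump : ℕ →. ℕ := fun a =>
  open Classical in
  Part.some
    (if ((Denumerable.ofNat Nat.Partrec.Code a.unpair.1).eval a.unpair.2).Dom then 1 else 0)

/-- A prefix machine with oracles `O` and conditions in `β`: a partial function
`(program, condition) ↦ output`, partial recursive in `O`, such that for every condition
the set of programs on which it is defined is prefix-free. -/
structure IsPrefixMachine {β : Type} [Primcodable β] (O : Set (ℕ →. ℕ))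
    (D : List Bool → β →. List Bool) : Prop where
  recursive : RecursiveIn₂ O D
  prefix_free : ∀ (b : β) (p q : List Bool),
    (D p b).Dom → (D q b).Dom → p <+: q → p = q

/-- The length of a shortest program on which `D` outputs `x` under the condition `b`
(`⊤` if there is none). -/
noncomputable def complexity {β : Type} (D : List Bool → β →. List Bool)
    (x : List Bool) (b : β) : ℕ∞ :=
  ⨅ (p : List Bool) (_ : x ∈ D p b), (p.length : ℕ∞)

/-- An (additively) optimal prefix machine. -/
structure IsOptimalPrefixMachine {β : Type} [Primcodable β] (O : Set (ℕ →. ℕ))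
    (D : List Bool → β →. List Bool) : Prop where
  isPrefixMachine : IsPrefixMachine O D
  optimal : ∀ D' : List Bool → β →. List Bool, IsPrefixMachine O D' →
    ∃ c : ℕ, ∀ (x : List Bool) (b : β), complexity D x b ≤ complexity D' x b + c

end LimitComplexity

namespace LimitComplexity

open Encodable Filter
open Nat.Partrec (Code)

variable {α β σ : Type} [Primcodable α] [Primcodable β] [Primcodable σ]

/-! ### Primitive recursive predicates -/

/-! Both bounds rest on one fact: a partial function is recursive in `zeroJump` iff its graph is Σ₂
(`isSigma2_graph_of_recursiveIn`, `recursiveIn_of_isSigma2`).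

Upper bound (`limsup_complexity_le`). Since the graph of `V` is Σ₂, `x ∈ V p` iff for some `s` a
fixed program diverges on the candidate `((p, x), s)`. Call a candidate alive at `n` if the program
has not halted on it within `n` steps. Under condition `n`, let `p` output `x` if some `((p, x), s)`
is alive and no alive candidate with a program comparable to `p` has a smaller code (`Selected`).
This is a computable prefix machine for every `n`. If `x ∈ V p`, the least true candidate for `(p,
x)` lives forever; the smaller comparable candidates are false, because the domain of `V` is
prefix-free, and being finitely many they are all dead from some `n` on. Hence `K(x|n) ≤ |p| + O(1)`
for all large `n`.

Lower bound (`complexity_le_limsup`). Let `E n` be the set of requests `(x, k)` with `K(x|n) ≤ k`.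
By Kraft each `E n` has weight `∑ 2⁻ᵏ` at most 2 (`weight_le_two`), and if the limsup is `k` then
`(x, k)` lies in `E n` for all `n` from some `N` on. That `N` is unknown, so all items `((x, k), N)`
are tried one after another: an item is accepted if its request is new and can be added to every `E
n` with `n ≥ N` without making a weight exceed 2. Refusal is Σ₁, so `zeroJump` decides it. A true
item changes no `E n`, so it is refused only when its request has already been accepted. All
accepted requests lie together in one enlarged family, so their total weight is at most 2, and code
words of length `k + 2` can be allotted online as disjoint dyadic intervals. This gives a prefix
machine with oracle `zeroJump`, to which the optimality of `V` applies. -/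

theorem primrecPred_exists_option {R : α × β → Prop} (hR : PrimrecPred R) {o : α → Option β}
    (ho : Primrec o) : PrimrecPred fun a => ∃ b, o a = some b ∧ R (a, b) := by
  classical
  have h : Primrec fun a => Option.casesOn (motive := fun _ => Bool) (o a) false
      fun b => decide (R (a, b)) :=
    Primrec.option_casesOn ho (Primrec.const false) hR.decide.to₂
  refine (Primrec.primrecPred (p := fun a => Option.casesOn (motive := fun _ => Bool) (o a) false
      (fun b => decide (R (a, b))) = true) (h.of_eq fun a => by simp)).of_eq fun a => ?_
  cases o a <;> simp

theorem primrecPred_forall_option {R : α × β → Prop} (hR : PrimrecPred R) {o : α → Option β}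
    (ho : Primrec o) : PrimrecPred fun a => ∀ b, o a = some b → R (a, b) :=
  (primrecPred_exists_option hR.not ho).not.of_eq fun a => by simp

theorem primrecPred_forall_mem {R : α × β → Prop} (hR : PrimrecPred R) {l : α → List β}
    (hl : Primrec l) : PrimrecPred fun a => ∀ b ∈ l a, R (a, b) :=
  PrimrecRel.comp (R := fun (L : List β) (a : α) => ∀ b ∈ L, R (a, b))
    (PrimrecRel.forall_mem_list (hR.comp (Primrec.snd.pair Primrec.fst))) hl Primrec.id

theorem primrecPred_exists_mem {R : α × β → Prop} (hR : PrimrecPred R) {l : α → List β}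
    (hl : Primrec l) : PrimrecPred fun a => ∃ b ∈ l a, R (a, b) :=
  (primrecPred_forall_mem hR.not hl).not.of_eq fun a => by simp

theorem primrecPred_forall_lt {R : α × ℕ → Prop} (hR : PrimrecPred R) {f : α → ℕ}
    (hf : Primrec f) : PrimrecPred fun a => ∀ i < f a, R (a, i) :=
  (primrecPred_forall_mem hR (Primrec.list_range.comp hf)).of_eq fun a => by simp

/-! ### The first levels of the arithmetical hierarchy -/

/-- Projections of primitive recursive predicates. -/
def IsSigma1 (P : α → Prop) : Prop :=
  ∃ R : α × ℕ → Prop, PrimrecPred R ∧ ∀ a, P a ↔ ∃ s, R (a, s)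

/-- Predicates of the form `∃ s, ∀ t, R a s t` with `R` primitive recursive. -/
def IsSigma2 (P : α → Prop) : Prop :=
  ∃ R : (α × ℕ) × ℕ → Prop, PrimrecPred R ∧ ∀ a, P a ↔ ∃ s, ∀ t, R ((a, s), t)

namespace IsSigma1

theorem of_exists {R : α × β → Prop} (hR : PrimrecPred R) : IsSigma1 fun a => ∃ b, R (a, b) := by
  refine ⟨fun x => ∃ b, decode (α := β) x.2 = some b ∧ R (x.1, b),
    primrecPred_exists_option (R := fun y : (α × ℕ) × β => R (y.1.1, y.2))
      (hR.comp ((Primrec.fst.comp Primrec.fst).pair Primrec.snd))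
      (Primrec.decode.comp Primrec.snd), fun a => ⟨?_, ?_⟩⟩
  · rintro ⟨b, hb⟩
    exact ⟨encode b, b, encodek b, hb⟩
  · rintro ⟨s, b, -, hb⟩
    exact ⟨b, hb⟩

theorem of_eq {P Q : α → Prop} (hP : IsSigma1 P) (h : ∀ a, P a ↔ Q a) : IsSigma1 Q :=
  (funext fun a => propext (h a) : P = Q) ▸ hP

theorem comp {P : β → Prop} (hP : IsSigma1 P) {f : α → β} (hf : Primrec f) :
    IsSigma1 fun a => P (f a) := by
  obtain ⟨R, hR, h⟩ := hP
  exact ⟨fun x => R (f x.1, x.2), hR.comp ((hf.comp Primrec.fst).pair Primrec.snd),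
    fun a => h (f a)⟩

theorem exists' {P : α × β → Prop} (hP : IsSigma1 P) : IsSigma1 fun a => ∃ b, P (a, b) := by
  obtain ⟨R, hR, h⟩ := hP
  refine (of_exists (R := fun x : α × (β × ℕ) => R ((x.1, x.2.1), x.2.2))
    (hR.comp ((Primrec.fst.pair (Primrec.fst.comp Primrec.snd)).pair
      (Primrec.snd.comp Primrec.snd)))).of_eq fun a => ?_
  simp [h]

theorem and_primrecPred {P Q : α → Prop} (hP : PrimrecPred P) (hQ : IsSigma1 Q) :
    IsSigma1 fun a => P a ∧ Q a := by
  obtain ⟨R, hR, h⟩ := hQ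
  exact ⟨fun x => P x.1 ∧ R x, (hP.comp Primrec.fst).and hR, fun a => by simp [h]⟩

end IsSigma1

namespace IsSigma2

theorem of_eq {P Q : α → Prop} (hP : IsSigma2 P) (h : ∀ a, P a ↔ Q a) : IsSigma2 Q :=
  (funext fun a => propext (h a) : P = Q) ▸ hP

theorem of_isSigma1 {P : α → Prop} (hP : IsSigma1 P) : IsSigma2 P := by
  obtain ⟨R, hR, h⟩ := hP
  exact ⟨fun x => R x.1, hR.comp Primrec.fst, fun a => by simp [h]⟩

theorem of_not_isSigma1 {P : α → Prop} (hP : IsSigma1 P) : IsSigma2 fun a => ¬ P a := by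
  obtain ⟨R, hR, h⟩ := hP
  exact ⟨fun x => ¬ R (x.1.1, x.2),
    (hR.comp ((Primrec.fst.comp Primrec.fst).pair Primrec.snd)).not, fun a => by simp [h]⟩

theorem of_primrecPred {P : α → Prop} (hP : PrimrecPred P) : IsSigma2 P :=
  ⟨fun x => P x.1.1, hP.comp (Primrec.fst.comp Primrec.fst), fun a => by simp⟩

theorem comp {P : β → Prop} (hP : IsSigma2 P) {f : α → β} (hf : Primrec f) :
    IsSigma2 fun a => P (f a) := by
  obtain ⟨R, hR, h⟩ := hP
  exact ⟨fun x => R ((f x.1.1, x.1.2), x.2),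
    hR.comp (((hf.comp (Primrec.fst.comp Primrec.fst)).pair
      (Primrec.snd.comp Primrec.fst)).pair Primrec.snd), fun a => h (f a)⟩

theorem exists' {P : α × β → Prop} (hP : IsSigma2 P) : IsSigma2 fun a => ∃ b, P (a, b) := by
  obtain ⟨R, hR, h⟩ := hP
  refine ⟨fun x => ∃ y, decode (α := β × ℕ) x.1.2 = some y ∧ R (((x.1.1, y.1), y.2), x.2),
    primrecPred_exists_option
      (R := fun z : ((α × ℕ) × ℕ) × (β × ℕ) => R (((z.1.1.1, z.2.1), z.2.2), z.1.2))
      (hR.comp ?_) (Primrec.decode.comp (Primrec.snd.comp Primrec.fst)), fun a => ⟨?_, ?_⟩⟩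
  · exact (((Primrec.fst.comp (Primrec.fst.comp Primrec.fst)).pair
      (Primrec.fst.comp Primrec.snd)).pair (Primrec.snd.comp Primrec.snd)).pair
      (Primrec.snd.comp Primrec.fst)
  · rintro ⟨b, hb⟩
    obtain ⟨s, hs⟩ := (h _).1 hb
    exact ⟨encode (b, s), fun t => ⟨(b, s), encodek _, hs t⟩⟩
  · rintro ⟨s, hs⟩
    -- The pair decoded from `s` does not depend on `t`, so the one found at `t = 0` serves every
    -- `t`.
    obtain ⟨y, hy, -⟩ := hs 0
    refine ⟨y.1, (h _).2 ⟨y.2, fun t => ?_⟩⟩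
    obtain ⟨z, hz, hR⟩ := hs t
    obtain rfl : y = z := Option.some_injective _ (hy.symm.trans hz)
    exact hR

/-- Bounded quantifiers are absorbed by collecting the finitely many witnesses into one list, which
moves the existential quantifier to the front. -/
theorem forall_lt {P : α × ℕ → Prop} (hP : IsSigma2 P) {f : α → ℕ} (hf : Primrec f) :
    IsSigma2 fun a => ∀ i < f a, P (a, i) := by
  obtain ⟨R, hR, h⟩ := hP
  have key : IsSigma2 fun a => ∃ l : List ℕ, ∀ t, ∀ i < f a, R (((a, i), l.getD i 0), t) := by
    refine exists' (P := fun x : α × List ℕ => ∀ t, ∀ i < f x.1, R (((x.1, i), x.2.getD i 0), t))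
      ⟨fun x => ∀ i < f x.1.1.1, R (((x.1.1.1, i), x.1.1.2.getD i 0), x.2),
        primrecPred_forall_lt (R := fun z : (((α × List ℕ) × ℕ) × ℕ) × ℕ =>
          R (((z.1.1.1.1, z.2), z.1.1.1.2.getD z.2 0), z.1.2)) (hR.comp ?_)
          (hf.comp (Primrec.fst.comp (Primrec.fst.comp Primrec.fst))), fun a => by simp⟩
    have h1 : Primrec fun z : (((α × List ℕ) × ℕ) × ℕ) × ℕ => z.1.1.1 :=
      Primrec.fst.comp (Primrec.fst.comp Primrec.fst)
    exact (((Primrec.fst.comp h1).pair Primrec.snd).pair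
      ((Primrec.list_getD 0).comp (Primrec.snd.comp h1) Primrec.snd)).pair
      (Primrec.snd.comp Primrec.fst)
  refine key.of_eq fun a => ⟨?_, fun H => ?_⟩
  · rintro ⟨l, hl⟩ i hi
    exact (h _).2 ⟨_, fun t => hl t i hi⟩
  · have : ∀ i, ∃ s, i < f a → ∀ t, R (((a, i), s), t) := fun i => by
      by_cases hi : i < f a
      · obtain ⟨s, hs⟩ := (h _).1 (H i hi)
        exact ⟨s, fun _ => hs⟩
      · exact ⟨0, fun h => absurd h hi⟩
    choose s hs using this
    refine ⟨(List.range (f a)).map s, fun t i hi => ?_⟩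
    simpa [List.getD, hi] using hs i hi t

theorem and {P Q : α → Prop} (hP : IsSigma2 P) (hQ : IsSigma2 Q) :
    IsSigma2 fun a => P a ∧ Q a := by
  obtain ⟨R, hR, h⟩ := hP
  obtain ⟨S, hS, h'⟩ := hQ
  have e1 : Primrec fun x : ((α × ℕ × ℕ) × ℕ) × ℕ => ((x.1.1.1, x.1.1.2.1), x.2) :=
    ((Primrec.fst.comp (Primrec.fst.comp Primrec.fst)).pair
      (Primrec.fst.comp (Primrec.snd.comp (Primrec.fst.comp Primrec.fst)))).pair Primrec.snd
  have e2 : Primrec fun x : ((α × ℕ × ℕ) × ℕ) × ℕ => ((x.1.1.1, x.1.1.2.2), x.2) :=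
    ((Primrec.fst.comp (Primrec.fst.comp Primrec.fst)).pair
      (Primrec.snd.comp (Primrec.snd.comp (Primrec.fst.comp Primrec.fst)))).pair Primrec.snd
  have key : IsSigma2 fun a => ∃ b : ℕ × ℕ, ∀ t, R ((a, b.1), t) ∧ S ((a, b.2), t) :=
    exists' (P := fun x : α × (ℕ × ℕ) => ∀ t, R ((x.1, x.2.1), t) ∧ S ((x.1, x.2.2), t))
      ⟨_, (hR.comp e1).and (hS.comp e2), fun a => by simp⟩
  refine key.of_eq fun a => ?_
  rw [h, h']
  constructor
  · rintro ⟨b, hb⟩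
    exact ⟨⟨b.1, fun t => (hb t).1⟩, ⟨b.2, fun t => (hb t).2⟩⟩
  · rintro ⟨⟨s, hs⟩, ⟨s', hs'⟩⟩
    exact ⟨(s, s'), fun t => ⟨hs t, hs' t⟩⟩

theorem or {P Q : α → Prop} (hP : IsSigma2 P) (hQ : IsSigma2 Q) :
    IsSigma2 fun a => P a ∨ Q a := by
  obtain ⟨R, hR, h⟩ := hP
  obtain ⟨S, hS, h'⟩ := hQ
  have e : Primrec fun x : ((α × Bool) × ℕ) × ℕ => ((x.1.1.1, x.1.2), x.2) :=
    ((Primrec.fst.comp (Primrec.fst.comp Primrec.fst)).pair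
      (Primrec.snd.comp Primrec.fst)).pair Primrec.snd
  have hb : Primrec fun x : ((α × Bool) × ℕ) × ℕ => x.1.1.2 :=
    Primrec.snd.comp (Primrec.fst.comp Primrec.fst)
  have key : IsSigma2 fun a => ∃ b : Bool,
      ∃ s, ∀ t, (b = true ∧ R ((a, s), t)) ∨ (b = false ∧ S ((a, s), t)) :=
    exists' (P := fun x : α × Bool =>
        ∃ s, ∀ t, (x.2 = true ∧ R ((x.1, s), t)) ∨ (x.2 = false ∧ S ((x.1, s), t)))
      ⟨_, ((Primrec.eq.comp hb (Primrec.const true)).and (hR.comp e)).or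
        ((Primrec.eq.comp hb (Primrec.const false)).and (hS.comp e)), fun a => Iff.rfl⟩
  exact key.of_eq fun a => by simp [h, h', or_comm]

end IsSigma2

/-! ### Partial recursive functions and their graphs -/

theorem exists_code_of_partrec {f : α →. σ} (hf : Partrec f) :
    ∃ c : Code, ∀ a y, y ∈ f a ↔ encode y ∈ c.eval (encode a) := by
  obtain ⟨c, hc⟩ := Code.exists_code.1 hf
  refine ⟨c, fun a y => ?_⟩
  simp [hc]

/-- Search through all pairs of a value and a witness; as `f` is single-valued, any hit gives the
right value. -/
theorem partrec_of_isSigma1 {f : α →. σ} (h : IsSigma1 fun x : α × σ => x.2 ∈ f x.1) :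
    Partrec f := by
  classical
  obtain ⟨R, hR, h⟩ := h
  have hp : Primrec₂ fun (a : α) (k : ℕ) => (decode (α := σ × ℕ) k).bind
      fun y => if R ((a, y.1), y.2) then some y.1 else none := by
    refine Primrec.option_bind (Primrec.decode.comp Primrec.snd) ?_
    refine Primrec.ite (hR.comp ?_) (Primrec.option_some.comp (Primrec.fst.comp Primrec.snd))
      (Primrec.const none)
    exact ((Primrec.fst.comp Primrec.fst).pair (Primrec.fst.comp Primrec.snd)).pair
      (Primrec.snd.comp Primrec.snd)
  refine (Partrec.rfindOpt hp.to_comp).of_eq fun a => Part.ext fun y => ?_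
  have spec : ∀ k z, z ∈ ((decode (α := σ × ℕ) k).bind
      fun y => if R ((a, y.1), y.2) then some y.1 else none) → z ∈ f a := by
    intro k z hz
    simp only [Option.mem_def, Option.bind_eq_some_iff, Option.ite_none_right_eq_some] at hz
    obtain ⟨w, -, hw, hz⟩ := hz
    rw [Option.some_inj] at hz
    subst hz
    exact (h (a, w.1)).2 ⟨_, hw⟩
  constructor
  · intro hy
    obtain ⟨k, hk⟩ := Nat.rfindOpt_spec hy
    exact spec k y hk
  · intro hy
    obtain ⟨s, hs⟩ := (h (a, y)).1 hy
    have hd : (Nat.rfindOpt fun k => (decode (α := σ × ℕ) k).bind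
        fun y => if R ((a, y.1), y.2) then some y.1 else none).Dom :=
      Nat.rfindOpt_dom.2 ⟨encode (y, s), y, by simp [hs]⟩
    obtain ⟨z, hz⟩ := Part.dom_iff_mem.1 hd
    obtain ⟨k, hk⟩ := Nat.rfindOpt_spec hz
    rwa [Part.mem_unique hy (spec k z hk)]

/-- On input `(a, s)` the program looks for a `t` refuting `R ((a, s), t)`, so it diverges exactly
when `s` is a correct witness. Divergence is what the oracle answers about and what can be
approximated by stages. -/
theorem exists_code_of_isSigma2 {P : α → Prop} (hP : IsSigma2 P) :
    ∃ c : Code, ∀ a, P a ↔ ∃ s : ℕ, ¬ (c.eval (encode (a, s))).Dom := by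
  classical
  obtain ⟨R, hR, h⟩ := hP
  have hp : Partrec fun x : α × ℕ => Nat.rfind fun t => Part.some (!decide (R (x, t))) :=
    Partrec.rfind (Primrec.not.comp hR.decide).to_comp.partrec
  obtain ⟨c, hc⟩ := exists_code_of_partrec hp
  refine ⟨c, fun a => (h a).trans (exists_congr fun s => ?_)⟩
  rw [← not_iff_not, not_not, Part.dom_iff_mem, not_forall]
  have : (∃ y, y ∈ c.eval (encode (a, s))) ↔
      ((Nat.rfind fun t => Part.some (!decide (R ((a, s), t))) : Part ℕ)).Dom := by
    rw [Part.dom_iff_mem]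
    constructor
    · rintro ⟨y, hy⟩
      exact ⟨y, (hc (a, s) y).2 hy⟩
    · rintro ⟨y, hy⟩
      exact ⟨_, (hc (a, s) y).1 hy⟩
  refine Iff.trans ?_ (this.trans Nat.rfind_dom).symm
  constructor
  · rintro ⟨t, ht⟩
    exact ⟨t, by simpa using ht, fun _ => trivial⟩
  · rintro ⟨t, ht, -⟩
    exact ⟨t, by simpa using ht⟩

theorem isSigma1_eval_dom :
    IsSigma1 fun a : ℕ × ℕ => ((Denumerable.ofNat Code a.1).eval a.2).Dom := by
  refine IsSigma1.of_eq (P := fun a : ℕ × ℕ => ∃ k : ℕ,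
    (Code.evaln k (Denumerable.ofNat Code a.1) a.2).isSome = true) (IsSigma1.of_exists
      (R := fun x : (ℕ × ℕ) × ℕ =>
        (Code.evaln x.2 (Denumerable.ofNat Code x.1.1) x.1.2).isSome = true) ?_) fun a => ?_
  · refine Primrec.eq.comp (Primrec.option_isSome.comp (Code.primrec_evaln.comp
      ((Primrec.snd.pair ((Primrec.ofNat Code).comp (Primrec.fst.comp Primrec.fst))).pair
        (Primrec.snd.comp Primrec.fst)))) (Primrec.const true)
  · simp only [Part.dom_iff_mem, Code.evaln_complete, Option.isSome_iff_exists, Option.mem_def]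
    exact exists_comm

/-- A finite run of a process with Σ₂ steps is coded by the list of its states. It serves both
primitive recursion and the greedy procedure. -/
theorem IsSigma2.path {F : α × σ → Prop} {G : (α × ℕ × σ) × σ → Prop} (hF : IsSigma2 F)
    (hG : IsSigma2 G) : IsSigma2 fun x : (α × ℕ) × σ => ∃ Z : ℕ → σ, F (x.1.1, Z 0) ∧
      (∀ j < x.1.2, G ((x.1.1, j, Z j), Z (j + 1))) ∧ Z x.1.2 = x.2 := by
  have key : IsSigma2 fun x : (α × ℕ) × σ => ∃ l : List σ,
      (∃ z, l[0]? = some z ∧ F (x.1.1, z)) ∧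
      (∀ j < x.1.2, ∃ u : σ × σ, (l[j]? = some u.1 ∧ l[j + 1]? = some u.2) ∧
        G ((x.1.1, j, u.1), u.2)) ∧ l[x.1.2]? = some x.2 := by
    refine IsSigma2.exists' (P := fun y : ((α × ℕ) × σ) × List σ =>
      (∃ z, y.2[0]? = some z ∧ F (y.1.1.1, z)) ∧
      (∀ j < y.1.1.2, ∃ u : σ × σ, (y.2[j]? = some u.1 ∧ y.2[j + 1]? = some u.2) ∧
        G ((y.1.1.1, j, u.1), u.2)) ∧ y.2[y.1.1.2]? = some y.1.2) ?_
    have ha : Primrec fun y : ((α × ℕ) × σ) × List σ => y.1.1.1 :=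
      Primrec.fst.comp (Primrec.fst.comp Primrec.fst)
    have hn : Primrec fun y : ((α × ℕ) × σ) × List σ => y.1.1.2 :=
      Primrec.snd.comp (Primrec.fst.comp Primrec.fst)
    refine IsSigma2.and ?_ (IsSigma2.and ?_ (IsSigma2.of_primrecPred ?_))
    · refine IsSigma2.exists' (P := fun y : (((α × ℕ) × σ) × List σ) × σ =>
        y.1.2[0]? = some y.2 ∧ F (y.1.1.1.1, y.2)) (IsSigma2.and (IsSigma2.of_primrecPred ?_) ?_)
      · exact Primrec.eq.comp (Primrec.list_getElem?.comp (Primrec.snd.comp Primrec.fst)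
          (Primrec.const 0)) (Primrec.option_some.comp Primrec.snd)
      · exact hF.comp ((ha.comp Primrec.fst).pair Primrec.snd)
    · refine IsSigma2.forall_lt (P := fun y : (((α × ℕ) × σ) × List σ) × ℕ =>
        ∃ u : σ × σ, (y.1.2[y.2]? = some u.1 ∧ y.1.2[y.2 + 1]? = some u.2) ∧
        G ((y.1.1.1.1, y.2, u.1), u.2)) ?_ hn
      refine IsSigma2.exists' (P := fun y : ((((α × ℕ) × σ) × List σ) × ℕ) × (σ × σ) =>
        (y.1.1.2[y.1.2]? = some y.2.1 ∧ y.1.1.2[y.1.2 + 1]? = some y.2.2) ∧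
        G ((y.1.1.1.1.1, y.1.2, y.2.1), y.2.2)) ?_
      have hl : Primrec fun y : ((((α × ℕ) × σ) × List σ) × ℕ) × (σ × σ) => y.1.1.2 :=
        Primrec.snd.comp (Primrec.fst.comp Primrec.fst)
      have hj : Primrec fun y : ((((α × ℕ) × σ) × List σ) × ℕ) × (σ × σ) => y.1.2 :=
        Primrec.snd.comp Primrec.fst
      have hu : Primrec fun y : ((((α × ℕ) × σ) × List σ) × ℕ) × (σ × σ) => y.2.1 :=
        Primrec.fst.comp Primrec.snd
      have hv : Primrec fun y : ((((α × ℕ) × σ) × List σ) × ℕ) × (σ × σ) => y.2.2 :=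
        Primrec.snd.comp Primrec.snd
      refine IsSigma2.and (IsSigma2.of_primrecPred (PrimrecPred.and ?_ ?_)) ?_
      · exact Primrec.eq.comp (Primrec.list_getElem?.comp hl hj) (Primrec.option_some.comp hu)
      · exact Primrec.eq.comp (Primrec.list_getElem?.comp hl (Primrec.succ.comp hj))
          (Primrec.option_some.comp hv)
      · exact hG.comp (((ha.comp (Primrec.fst.comp Primrec.fst)).pair (hj.pair hu)).pair hv)
    · exact Primrec.eq.comp (Primrec.list_getElem?.comp Primrec.snd hn)
        (Primrec.option_some.comp (Primrec.snd.comp Primrec.fst))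
  refine key.of_eq fun ⟨⟨a, n⟩, s⟩ => ⟨?_, ?_⟩
  · rintro ⟨l, ⟨z, hz, hF⟩, hl, hn⟩
    -- The default `s` is never used at the relevant indices: `l` has entries at all positions up to
    -- `n`.
    refine ⟨fun j => l.getD j s, by simpa [List.getD, hz] using hF, fun j hj => ?_,
      by simp only at hn; simp [List.getD, hn]⟩
    obtain ⟨u, ⟨h1, h2⟩, h3⟩ := hl j hj
    simpa only [List.getD, h1, h2, Option.getD_some] using h3
  · rintro ⟨Z, h0, hZ, hn⟩
    simp only at h0 hZ hn
    refine ⟨(List.range (n + 1)).map Z, ⟨Z 0, by simp, h0⟩, fun j hj => ⟨(Z j, Z (j + 1)), ⟨?_, ?_⟩,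
      hZ j hj⟩, by simp [hn]⟩
    · simp only at hj
      simp [show j < n + 1 by omega]
    · simp only at hj
      simp [show j + 1 < n + 1 by omega]

theorem mem_natRec_iff {σ : Type*} {f : Part σ} {g : ℕ → σ → Part σ} {n : ℕ} {y : σ} :
    (y ∈ (Nat.rec f (fun j IH => IH.bind (g j)) n : Part σ)) ↔
      ∃ Z : ℕ → σ, Z 0 ∈ f ∧ (∀ j < n, Z (j + 1) ∈ g j (Z j)) ∧ Z n = y := by
  induction n generalizing y with
  | zero => exact ⟨fun h => ⟨fun _ => y, h, by simp, rfl⟩, fun ⟨Z, h0, _, h⟩ => h ▸ h0⟩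
  | succ n ih =>
    simp only [Part.mem_bind_iff, ih]
    constructor
    · rintro ⟨z, ⟨Z, h0, hZ, rfl⟩, hy⟩
      refine ⟨fun j => if j ≤ n then Z j else y, by simpa using h0, fun j hj => ?_, by simp⟩
      rcases Nat.lt_succ_iff_lt_or_eq.1 hj with h | rfl
      · simpa [show j ≤ n by omega, show j + 1 ≤ n by omega] using hZ j h
      · simpa using hy
    · rintro ⟨Z, h0, hZ, rfl⟩
      exact ⟨Z n, ⟨Z, h0, fun j hj => hZ j (by omega), rfl⟩, hZ n (by omega)⟩

/-! ### Recursiveness in `zeroJump` and Σ₂ graphs -/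

theorem isSigma2_graph_zeroJump : IsSigma2 fun x : ℕ × ℕ => x.2 ∈ zeroJump x.1 := by
  have h : IsSigma1 fun x : ℕ × ℕ =>
      ((Denumerable.ofNat Code x.1.unpair.1).eval x.1.unpair.2).Dom :=
    isSigma1_eval_dom.comp (Primrec.unpair.comp Primrec.fst)
  have h1 : PrimrecPred fun x : ℕ × ℕ => x.2 = 1 := Primrec.eq.comp Primrec.snd (Primrec.const 1)
  have h0 : PrimrecPred fun x : ℕ × ℕ => x.2 = 0 := Primrec.eq.comp Primrec.snd (Primrec.const 0)
  refine (((IsSigma2.of_isSigma1 h).and (.of_primrecPred h1)).or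
    ((IsSigma2.of_not_isSigma1 h).and (.of_primrecPred h0))).of_eq fun x => ?_
  unfold zeroJump
  rw [Part.mem_some_iff]
  split_ifs with hd <;> simp [hd]

theorem isSigma2_graph_of_nat_recursiveIn {f : ℕ →. ℕ} (hf : Nat.RecursiveIn {zeroJump} f) :
    IsSigma2 fun x : ℕ × ℕ => x.2 ∈ f x.1 := by
  induction hf with
  | zero =>
    refine (IsSigma2.of_primrecPred (Primrec.eq.comp Primrec.snd (Primrec.const 0))).of_eq
      fun x => ?_
    exact (Part.mem_some_iff (a := 0) (b := x.2)).symm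
  | succ =>
    refine (IsSigma2.of_primrecPred (Primrec.eq.comp Primrec.snd
      (Primrec.succ.comp Primrec.fst))).of_eq fun x => ?_
    exact Part.mem_some_iff.symm
  | left =>
    refine (IsSigma2.of_primrecPred (Primrec.eq.comp Primrec.snd
      (Primrec.fst.comp (Primrec.unpair.comp Primrec.fst)))).of_eq fun x => ?_
    exact Part.mem_some_iff.symm
  | right =>
    refine (IsSigma2.of_primrecPred (Primrec.eq.comp Primrec.snd
      (Primrec.snd.comp (Primrec.unpair.comp Primrec.fst)))).of_eq fun x => ?_
    exact Part.mem_some_iff.symm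
  | oracle g hg =>
    obtain rfl := Set.mem_singleton_iff.1 hg
    exact isSigma2_graph_zeroJump
  | @pair f h _ _ ihf ihh =>
    refine (IsSigma2.exists' (P := fun y : (ℕ × ℕ) × (ℕ × ℕ) =>
      (y.2.1 ∈ f y.1.1 ∧ y.2.2 ∈ h y.1.1) ∧ y.1.2 = Nat.pair y.2.1 y.2.2)
      (((ihf.comp ((Primrec.fst.comp Primrec.fst).pair (Primrec.fst.comp Primrec.snd))).and
        (ihh.comp ((Primrec.fst.comp Primrec.fst).pair (Primrec.snd.comp Primrec.snd)))).and
        (.of_primrecPred (Primrec.eq.comp (Primrec.snd.comp Primrec.fst)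
          (Primrec₂.natPair.comp (Primrec.fst.comp Primrec.snd)
            (Primrec.snd.comp Primrec.snd)))))).of_eq fun x => ?_
    simp only [Seq.seq, Part.map_eq_map, Part.mem_bind_iff, Part.mem_map_iff,
      Prod.exists, exists_exists_and_eq_and]
    grind
  | @comp f h _ _ ihf ihh =>
    refine (IsSigma2.exists' (P := fun y : (ℕ × ℕ) × ℕ =>
      y.2 ∈ h y.1.1 ∧ y.1.2 ∈ f y.2)
      ((ihh.comp ((Primrec.fst.comp Primrec.fst).pair Primrec.snd)).and
        (ihf.comp (Primrec.snd.pair (Primrec.snd.comp Primrec.fst))))).of_eq fun x => ?_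
    exact (Part.mem_bind_iff (f := h x.1) (g := f) (b := x.2)).symm
  | @prec f h _ _ ihf ihh =>
    have e : Primrec fun y : (ℕ × ℕ × ℕ) × ℕ =>
        (Nat.pair y.1.1 (Nat.pair y.1.2.1 y.1.2.2), y.2) :=
      (Primrec₂.natPair.comp (Primrec.fst.comp Primrec.fst) (Primrec₂.natPair.comp
        (Primrec.fst.comp (Primrec.snd.comp Primrec.fst))
        (Primrec.snd.comp (Primrec.snd.comp Primrec.fst)))).pair Primrec.snd
    refine ((IsSigma2.path ihf (ihh.comp e)).comp (f := fun x : ℕ × ℕ => (x.1.unpair, x.2))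
      ((Primrec.unpair.comp Primrec.fst).pair Primrec.snd)).of_eq fun x => ?_
    exact (mem_natRec_iff (f := f x.1.unpair.1) (n := x.1.unpair.2) (y := x.2)
      (g := fun j z => h (Nat.pair x.1.unpair.1 (Nat.pair j z)))).symm
  | @rfind f _ ihf =>
    have e : Primrec fun x : ℕ × ℕ => (Nat.pair x.1 x.2, 0) :=
      (Primrec₂.natPair.comp Primrec.fst Primrec.snd).pair (Primrec.const 0)
    have e' : Primrec fun y : ((ℕ × ℕ) × ℕ) × ℕ => (Nat.pair y.1.1.1 y.1.2, y.2) :=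
      (Primrec₂.natPair.comp (Primrec.fst.comp (Primrec.fst.comp Primrec.fst))
        (Primrec.snd.comp Primrec.fst)).pair Primrec.snd
    refine ((ihf.comp e).and (IsSigma2.forall_lt (P := fun y : (ℕ × ℕ) × ℕ =>
      ∃ z, z ∈ f (Nat.pair y.1.1 y.2) ∧ ¬ z = 0) (IsSigma2.exists'
        (P := fun y : ((ℕ × ℕ) × ℕ) × ℕ => y.2 ∈ f (Nat.pair y.1.1.1 y.1.2) ∧ ¬ y.2 = 0)
        ((ihf.comp e').and (.of_primrecPred (Primrec.eq.comp Primrec.snd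
          (Primrec.const 0)).not))) Primrec.snd)).of_eq fun x => ?_
    refine Iff.trans ?_ Nat.mem_rfind.symm
    simp

theorem isSigma2_graph_of_recursiveIn {f : α →. σ} (hf : RecursiveIn {zeroJump} f) :
    IsSigma2 fun x : α × σ => x.2 ∈ f x.1 :=
  ((isSigma2_graph_of_nat_recursiveIn hf).comp (f := fun x : α × σ => (encode x.1, encode x.2))
    ((Primrec.encode.comp Primrec.fst).pair (Primrec.encode.comp Primrec.snd))).of_eq
      fun x => by simp

theorem zeroJump_eq_zero_iff {c : Code} {n : ℕ} :
    0 ∈ zeroJump (Nat.pair (encode c) n) ↔ ¬ (c.eval n).Dom := by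
  unfold zeroJump
  rw [Part.mem_some_iff]
  simp

/-- Search for the first code of a pair (value, witness) on which the oracle reports divergence, and
return the value. The oracle is total, so the search never gets stuck, and its answer 0 is just what
`rfind` looks for. -/
theorem nat_recursiveIn_of_isSigma2 {f : ℕ →. ℕ} (h : IsSigma2 fun x : ℕ × ℕ => x.2 ∈ f x.1) :
    Nat.RecursiveIn {zeroJump} f := by
  obtain ⟨c, hc⟩ := exists_code_of_isSigma2 h
  have hq : Primrec fun m : ℕ => Nat.pair (encode c)
      (encode ((m.unpair.1, m.unpair.2.unpair.1), m.unpair.2.unpair.2)) := by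
    have h2 : Primrec fun m : ℕ => m.unpair.2.unpair :=
      Primrec.unpair.comp (Primrec.snd.comp Primrec.unpair)
    exact Primrec₂.natPair.comp (Primrec.const _) (Primrec.encode.comp
      (((Primrec.fst.comp Primrec.unpair).pair (Primrec.fst.comp h2)).pair (Primrec.snd.comp h2)))
  have hz : Nat.RecursiveIn {zeroJump} zeroJump := .oracle _ rfl
  refine (Nat.RecursiveIn.comp .left (Nat.RecursiveIn.rfind
    (Nat.RecursiveIn.comp hz (Primrec.nat_iff.1 hq).recursiveIn))).of_eq fun n =>
      Part.ext fun y => ?_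
  have hz : ∀ m, ∃ z, zeroJump m = Part.some z := fun m => ⟨_, rfl⟩
  choose z hz using hz
  have hz0 : ∀ y s : ℕ, z (Nat.pair (encode c) (encode ((n, y), s))) = 0 ↔
      ¬ (c.eval (encode ((n, y), s))).Dom := fun y s => by
    rw [← zeroJump_eq_zero_iff, hz, Part.mem_some_iff, eq_comm]
  have spec : ∀ w : ℕ, z (Nat.pair (encode c) (encode ((n, w.unpair.1), w.unpair.2))) = 0 →
      w.unpair.1 ∈ f n := fun w hw => (hc _).2 ⟨_, (hz0 _ _).1 hw⟩
  have hmem : ∀ w, (w ∈ Nat.rfind fun k => (fun m => decide (m = 0)) <$>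
      (((Nat.pair (encode c) (encode (((Nat.pair n k).unpair.1, (Nat.pair n k).unpair.2.unpair.1),
        (Nat.pair n k).unpair.2.unpair.2)) : ℕ) : Part ℕ) >>= zeroJump)) ↔
      z (Nat.pair (encode c) (encode ((n, w.unpair.1), w.unpair.2))) = 0 ∧
      ∀ k < w, z (Nat.pair (encode c) (encode ((n, k.unpair.1), k.unpair.2))) ≠ 0 := by
    intro w
    have hb : ∀ m, (Part.some m >>= zeroJump) = Part.some (z m) := fun m =>
      (Part.bind_some m zeroJump).trans (hz m)
    refine Nat.mem_rfind.trans ?_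
    simp [hb]
  simp only [Part.bind_eq_bind, Part.mem_bind_iff] at hmem ⊢
  constructor
  · rintro ⟨w, hw, hy⟩
    obtain rfl := Part.mem_some_iff.1 hy
    exact spec w ((hmem w).1 hw).1
  · intro hy
    obtain ⟨s, hs⟩ := (hc (n, y)).1 hy
    have hex : ∃ w : ℕ, z (Nat.pair (encode c) (encode ((n, w.unpair.1), w.unpair.2))) = 0 :=
      ⟨Nat.pair y s, by simpa using (hz0 y s).2 hs⟩
    refine ⟨Nat.find hex, (hmem _).2 ⟨Nat.find_spec hex, fun k => Nat.find_min hex⟩, ?_⟩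
    rw [Part.mem_unique hy (spec _ (Nat.find_spec hex))]
    exact Part.mem_some _

theorem recursiveIn_of_isSigma2 {f : α →. σ} (h : IsSigma2 fun x : α × σ => x.2 ∈ f x.1) :
    RecursiveIn {zeroJump} f := by
  refine nat_recursiveIn_of_isSigma2 ?_
  refine (IsSigma2.exists' (P := fun y : (ℕ × ℕ) × (α × σ) =>
    (decode (α := α) y.1.1 = some y.2.1 ∧ y.1.2 = encode y.2.2) ∧ y.2.2 ∈ f y.2.1)
    ((IsSigma2.of_primrecPred (PrimrecPred.and
      (Primrec.eq.comp (Primrec.decode.comp (Primrec.fst.comp Primrec.fst))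
        (Primrec.option_some.comp (Primrec.fst.comp Primrec.snd)))
      (Primrec.eq.comp (Primrec.snd.comp Primrec.fst)
        (Primrec.encode.comp (Primrec.snd.comp Primrec.snd))))).and
    (h.comp Primrec.snd))).of_eq fun x => ?_
  simp only [Part.mem_bind_iff, Part.mem_ofOption, Part.mem_map_iff, Prod.exists, Option.mem_def]
  grind

/-! ### Machines given by their graphs -/

section Machines

variable {β : Type}

/-- The partial function whose graph is `G`, for functional `G`. -/
noncomputable def machineOf (G : List Bool → β → List Bool → Prop) :
    List Bool → β →. List Bool :=
  fun p b => ⟨∃ x, G p b x, fun h => h.choose⟩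

/-- Under every condition, `G` is the graph of a partial function with prefix-free domain. -/
def IsPrefixFreeGraph (G : List Bool → β → List Bool → Prop) : Prop :=
  ∀ b p q x y, G p b x → G q b y → p <+: q → p = q ∧ x = y

theorem mem_machineOf {G : List Bool → β → List Bool → Prop} (hG : IsPrefixFreeGraph G)
    {p : List Bool} {b : β} {x : List Bool} : x ∈ machineOf G p b ↔ G p b x := by
  constructor
  · rintro ⟨h, rfl⟩
    exact h.choose_spec
  · intro h
    have hd : ∃ x, G p b x := ⟨x, h⟩
    exact ⟨hd, (hG b p p _ x hd.choose_spec h (List.prefix_refl p)).2⟩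

theorem complexity_le {D : List Bool → β →. List Bool} {x p : List Bool} {b : β}
    (h : x ∈ D p b) : complexity D x b ≤ p.length :=
  iInf₂_le p h

theorem exists_program {D : List Bool → β →. List Bool} {x : List Bool} {b : β} {m : ℕ}
    (h : complexity D x b ≤ m) : ∃ p, x ∈ D p b ∧ p.length ≤ m := by
  by_contra! H
  have : ((m + 1 : ℕ) : ℕ∞) ≤ complexity D x b :=
    le_iInf₂ fun p hp => by exact_mod_cast H p hp
  have := this.trans h
  norm_cast at this
  omega

theorem complexity_le_add {D D' : List Bool → β →. List Bool} {x : List Bool} {b : β} {c : ℕ}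
    (h : ∀ p, x ∈ D' p b → ∃ q, x ∈ D q b ∧ q.length ≤ p.length + c) :
    complexity D x b ≤ complexity D' x b + c := by
  rcases eq_or_ne (complexity D' x b) ⊤ with htop | htop
  · simp [htop]
  · lift complexity D' x b to ℕ using htop with m hm
    obtain ⟨p, hp, hpm⟩ := exists_program hm.symm.le
    obtain ⟨q, hq, hqp⟩ := h p hp
    refine (complexity_le hq).trans ?_
    norm_cast
    omega

variable [Primcodable β] {O : Set (ℕ →. ℕ)}

theorem isPrefixMachine_machineOf {G : List Bool → β → List Bool → Prop}
    (hG : IsPrefixFreeGraph G) (hrec : RecursiveIn₂ O (machineOf G)) :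
    IsPrefixMachine O (machineOf G) where
  recursive := hrec
  prefix_free := fun b p q ⟨_, hx⟩ ⟨_, hy⟩ hpq => (hG b p q _ _ hx hy hpq).1

theorem IsPrefixMachine.isPrefixFreeGraph {D : List Bool → β →. List Bool}
    (hD : IsPrefixMachine O D) : IsPrefixFreeGraph fun p b x => x ∈ D p b := by
  intro b p q x y hx hy hpq
  obtain rfl := hD.prefix_free b p q (Part.dom_iff_mem.2 ⟨x, hx⟩) (Part.dom_iff_mem.2 ⟨y, hy⟩) hpq
  exact ⟨rfl, Part.mem_unique hx hy⟩

end Machines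

/-! ### Pruning an enumeration to a prefix-free one -/

/-- A program, an output, and a stage or witness. -/
abbrev Candidate : Type := (List Bool × List Bool) × ℕ

/-- `((p, x), s)` satisfies `T` for some `s`, and is not preceded (in the order of codes) by a
candidate satisfying `T` with a program comparable to `p`. -/
def Selected (T : Candidate → Prop) (p x : List Bool) : Prop :=
  ∃ s : ℕ, T ((p, x), s) ∧ ∀ y : Candidate, encode y < encode (((p, x), s) : Candidate) →
    (y.1.1 <+: p ∨ p <+: y.1.1) → ¬ T y

/-- Of two different candidates with comparable programs, the one with the smaller code blocks the
other. Nothing is assumed about `T`, so the pruned relation is always a prefix-free graph. -/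
theorem Selected.eq_of_prefix {T : Candidate → Prop} {p q x y : List Bool} (hp : Selected T p x)
    (hq : Selected T q y) (hpq : p <+: q) : p = q ∧ x = y := by
  obtain ⟨s, hs, hs'⟩ := hp
  obtain ⟨r, hr, hr'⟩ := hq
  rcases lt_trichotomy (encode (((p, x), s) : Candidate)) (encode (((q, y), r) : Candidate)) with
    h | h | h
  · exact absurd hs (hr' _ h (Or.inl hpq))
  · have := encode_injective h
    simp only [Prod.mk.injEq] at this
    exact this.1
  · exact absurd hr (hs' _ h (Or.inr hpq))

theorem exists_isLeast_candidate {T : Candidate → Prop} {p x : List Bool}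
    (h : ∃ s : ℕ, T ((p, x), s)) : ∃ s : ℕ, T ((p, x), s) ∧
      ∀ r : ℕ, encode (((p, x), r) : Candidate) < encode (((p, x), s) : Candidate) →
        ¬ T ((p, x), r) := by
  obtain ⟨s, hs, hmin⟩ := WellFounded.has_min
    (InvImage.wf (fun s : ℕ => encode (((p, x), s) : Candidate)) wellFounded_lt)
    {s | T ((p, x), s)} h
  exact ⟨s, hs, fun r hr hT => hmin r hT hr⟩

/-- Pruning loses nothing when `T` already comes from a prefix machine: the least candidate for `(p,
x)` has no competitor. -/
theorem selected_of_exists {T : Candidate → Prop} {p x : List Bool}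
    (hT : ∀ y : Candidate, T y → (y.1.1 <+: p ∨ p <+: y.1.1) → y.1 = (p, x))
    (h : ∃ s : ℕ, T ((p, x), s)) : Selected T p x := by
  obtain ⟨s, hs, hmin⟩ := exists_isLeast_candidate h
  refine ⟨s, hs, fun ⟨y, r⟩ hlt hc hy => ?_⟩
  obtain rfl : y = (p, x) := hT _ hy hc
  exact hmin r hlt hy

/-- Quantifying over codes below a bound keeps the complexity low. The clause `encode y = w` allows
a property of `encode y` to be read as a property of the number `w`. -/
theorem selected_iff_forall_lt {T : Candidate → Prop} {p x : List Bool} :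
    Selected T p x ↔ ∃ s : ℕ, T ((p, x), s) ∧ ∀ w < encode (((p, x), s) : Candidate),
      ∀ y : Candidate, decode w = some y →
        ¬ ((encode y = w ∧ (y.1.1 <+: p ∨ p <+: y.1.1)) ∧ T y) := by
  refine exists_congr fun s => and_congr_right fun _ => ⟨?_, ?_⟩
  · rintro h w hw y - ⟨⟨rfl, hc⟩, hy⟩
    exact h y hw hc hy
  · intro h y hy hc hT
    exact h _ hy y (encodek y) ⟨⟨rfl, hc⟩, hT⟩

variable {γ : Type} [Primcodable γ]

theorem primrecRel_prefix : PrimrecRel fun p q : List Bool => p <+: q :=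
  (Primrec.eq.comp Primrec.fst (Primrec.list_take.comp (Primrec.list_length.comp Primrec.fst)
    Primrec.snd)).of_eq fun _ => List.prefix_iff_eq_take.symm

theorem primrecPred_encode_eq_and_comparable : PrimrecPred fun z : (ℕ × List Bool) × Candidate =>
    encode z.2 = z.1.1 ∧ (z.2.1.1 <+: z.1.2 ∨ z.1.2 <+: z.2.1.1) := by
  have hq : Primrec fun z : (ℕ × List Bool) × Candidate => z.2.1.1 :=
    Primrec.fst.comp (Primrec.fst.comp Primrec.snd)
  have hp : Primrec fun z : (ℕ × List Bool) × Candidate => z.1.2 := Primrec.snd.comp Primrec.fst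
  exact (Primrec.eq.comp (Primrec.encode.comp Primrec.snd) (Primrec.fst.comp Primrec.fst)).and
    ((primrecRel_prefix.comp hq hp).or (primrecRel_prefix.comp hp hq))

theorem isSigma1_selected {T : γ → Candidate → Prop}
    (hT : PrimrecPred fun x : γ × Candidate => T x.1 x.2) :
    IsSigma1 fun z : γ × (List Bool × List Bool) => Selected (T z.1) z.2.1 z.2.2 := by
  refine (IsSigma1.of_exists (R := fun v : (γ × (List Bool × List Bool)) × ℕ =>
    T v.1.1 (v.1.2, v.2) ∧ ∀ w < encode ((v.1.2, v.2) : Candidate),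
      ∀ y : Candidate, decode w = some y →
        ¬ ((encode y = w ∧ (y.1.1 <+: v.1.2.1 ∨ v.1.2.1 <+: y.1.1)) ∧ T v.1.1 y))
    (PrimrecPred.and ?_ ?_)).of_eq fun z =>
      (selected_iff_forall_lt (T := T z.1) (p := z.2.1) (x := z.2.2)).symm
  · exact hT.comp ((Primrec.fst.comp Primrec.fst).pair
      ((Primrec.snd.comp Primrec.fst).pair Primrec.snd))
  · refine primrecPred_forall_lt (R := fun v : ((γ × (List Bool × List Bool)) × ℕ) × ℕ =>
      ∀ y : Candidate, decode v.2 = some y →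
        ¬ ((encode y = v.2 ∧ (y.1.1 <+: v.1.1.2.1 ∨ v.1.1.2.1 <+: y.1.1)) ∧ T v.1.1.1 y)) ?_
      (Primrec.encode.comp ((Primrec.snd.comp Primrec.fst).pair Primrec.snd))
    refine primrecPred_forall_option
      (R := fun v : (((γ × (List Bool × List Bool)) × ℕ) × ℕ) × Candidate =>
        ¬ ((encode v.2 = v.1.2 ∧ (v.2.1.1 <+: v.1.1.1.2.1 ∨ v.1.1.1.2.1 <+: v.2.1.1)) ∧
          T v.1.1.1.1 v.2)) (PrimrecPred.not (PrimrecPred.and ?_ ?_))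
      (Primrec.decode.comp Primrec.snd)
    · have h3 : Primrec fun v : (((γ × (List Bool × List Bool)) × ℕ) × ℕ) × Candidate =>
          v.1.1.1 := Primrec.fst.comp (Primrec.fst.comp Primrec.fst)
      exact primrecPred_encode_eq_and_comparable.comp (((Primrec.snd.comp Primrec.fst).pair
        (Primrec.fst.comp (Primrec.snd.comp h3))).pair Primrec.snd)
    · exact hT.comp ((Primrec.fst.comp (Primrec.fst.comp (Primrec.fst.comp Primrec.fst))).pair
        Primrec.snd)

/-- Being a candidate is Π₁ here, so the absence of an earlier one is a bounded quantifier over Σ₁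
conditions, and Σ₂ is closed under it. -/
theorem isSigma2_selected_not_dom :
    IsSigma2 fun z : ℕ × (List Bool × List Bool) =>
      Selected (fun y => ¬ ((Denumerable.ofNat Code z.1).eval (encode y)).Dom) z.2.1 z.2.2 := by
  have hD := isSigma1_eval_dom
  refine (IsSigma2.exists' (P := fun v : (ℕ × (List Bool × List Bool)) × ℕ =>
    (¬ ((Denumerable.ofNat Code v.1.1).eval (encode ((v.1.2, v.2) : Candidate))).Dom) ∧
    ∀ w < encode ((v.1.2, v.2) : Candidate),
      (∀ y : Candidate, decode w = some y →
        ¬ (encode y = w ∧ (y.1.1 <+: v.1.2.1 ∨ v.1.2.1 <+: y.1.1))) ∨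
      ((Denumerable.ofNat Code v.1.1).eval w).Dom)
    (IsSigma2.and ?_ ?_)).of_eq fun z => Iff.trans ?_ (selected_iff_forall_lt
      (T := fun y => ¬ ((Denumerable.ofNat Code z.1).eval (encode y)).Dom)
      (p := z.2.1) (x := z.2.2)).symm
  · exact IsSigma2.of_not_isSigma1 (hD.comp ((Primrec.fst.comp Primrec.fst).pair
      (Primrec.encode.comp ((Primrec.snd.comp Primrec.fst).pair Primrec.snd))))
  · refine IsSigma2.forall_lt (P := fun v : ((ℕ × (List Bool × List Bool)) × ℕ) × ℕ =>
      (∀ y : Candidate, decode v.2 = some y →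
        ¬ (encode y = v.2 ∧ (y.1.1 <+: v.1.1.2.1 ∨ v.1.1.2.1 <+: y.1.1))) ∨
      ((Denumerable.ofNat Code v.1.1.1).eval v.2).Dom) (IsSigma2.or (.of_primrecPred ?_)
        (.of_isSigma1 (hD.comp ((Primrec.fst.comp (Primrec.fst.comp Primrec.fst)).pair
          Primrec.snd))))
      (Primrec.encode.comp ((Primrec.snd.comp Primrec.fst).pair Primrec.snd))
    refine primrecPred_forall_option
      (R := fun v : (((ℕ × (List Bool × List Bool)) × ℕ) × ℕ) × Candidate =>
        ¬ (encode v.2 = v.1.2 ∧ (v.2.1.1 <+: v.1.1.1.2.1 ∨ v.1.1.1.2.1 <+: v.2.1.1)))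
      (PrimrecPred.not ?_) (Primrec.decode.comp Primrec.snd)
    have h3 : Primrec fun v : (((ℕ × (List Bool × List Bool)) × ℕ) × ℕ) × Candidate =>
        v.1.1.1 := Primrec.fst.comp (Primrec.fst.comp Primrec.fst)
    exact primrecPred_encode_eq_and_comparable.comp (((Primrec.snd.comp Primrec.fst).pair
      (Primrec.fst.comp (Primrec.snd.comp h3))).pair Primrec.snd)
  · refine exists_congr fun s => and_congr_right fun _ => forall₂_congr fun w _ => ?_
    constructor
    · rintro (h | h) y hy ⟨hc, hT⟩
      · exact h y hy hc
      · rw [hc.1] at hT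
        exact hT h
    · intro h
      by_cases hw : ((Denumerable.ofNat Code z.1).eval w).Dom
      · exact Or.inr hw
      · refine Or.inl fun y hy hc => h y hy ⟨hc, ?_⟩
        rwa [hc.1]

/-! ### Optimal machines -/

/-- The program `p` for the `e`-th machine. -/
def selfDelimit (e : ℕ) (p : List Bool) : List Bool := List.replicate e true ++ false :: p

theorem length_selfDelimit (e : ℕ) (p : List Bool) :
    (selfDelimit e p).length = p.length + (e + 1) := by
  simp [selfDelimit]
  omega

theorem eq_of_selfDelimit_prefix {e f : ℕ} {p q : List Bool}
    (h : selfDelimit e p <+: selfDelimit f q) : e = f ∧ p <+: q := by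
  induction e generalizing f with
  | zero =>
    cases f with
    | zero => simpa [selfDelimit] using h
    | succ f => simp [selfDelimit, List.replicate_succ] at h
  | succ e ih =>
    cases f with
    | zero => simp [selfDelimit, List.replicate_succ] at h
    | succ f =>
      have : selfDelimit e p <+: selfDelimit f q := by
        simpa [selfDelimit, List.replicate_succ] using h
      exact (ih this).imp_left (congrArg _)

theorem primrec_selfDelimit : Primrec₂ selfDelimit := by
  have h : Primrec fun e : ℕ => List.replicate e true := by
    refine (Primrec.list_map Primrec.list_range (Primrec₂.const true)).of_eq fun e => ?_
    simp
  exact Primrec.list_append.comp (h.comp Primrec.fst)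
    (Primrec.list_cons.comp (Primrec.const false) Primrec.snd)

/-- The graph of the machine that runs the `e`-th pruned enumeration on `p` when given the
program `selfDelimit e p`. -/
def universalGraph {β : Type} (T : ℕ → β → Candidate → Prop) (r : List Bool) (b : β)
    (x : List Bool) : Prop :=
  ∃ v : ℕ × List Bool, r = selfDelimit v.1 v.2 ∧ Selected (T v.1 b) v.2 x

theorem isPrefixFreeGraph_universalGraph {β : Type} (T : ℕ → β → Candidate → Prop) :
    IsPrefixFreeGraph (universalGraph T) := by
  rintro b r r' x y ⟨⟨e, p⟩, rfl, hx⟩ ⟨⟨f, q⟩, rfl, hy⟩ h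
  obtain ⟨rfl, hpq⟩ := eq_of_selfDelimit_prefix h
  obtain ⟨rfl, rfl⟩ := hx.eq_of_prefix hy hpq
  exact ⟨rfl, rfl⟩

/-- The universal machine runs all pruned enumerations in parallel. Pruning makes each of them
prefix-free and leaves genuine prefix machines unchanged; simulating the `e`-th one costs the `e +
1` bits of the header. -/
theorem isOptimalPrefixMachine_universalGraph {β : Type} [Primcodable β] {O : Set (ℕ →. ℕ)}
    {T : ℕ → β → Candidate → Prop} (hrec : RecursiveIn₂ O (machineOf (universalGraph T)))
    (huniv : ∀ D : List Bool → β →. List Bool, IsPrefixMachine O D →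
      ∃ e, ∀ p b x, x ∈ D p b ↔ ∃ s : ℕ, T e b ((p, x), s)) :
    IsOptimalPrefixMachine O (machineOf (universalGraph T)) where
  isPrefixMachine := isPrefixMachine_machineOf (isPrefixFreeGraph_universalGraph T) hrec
  optimal := by
    intro D hD
    obtain ⟨e, he⟩ := huniv D hD
    refine ⟨e + 1, fun x b => complexity_le_add fun p hp => ⟨selfDelimit e p, ?_,
      (length_selfDelimit e p).le⟩⟩
    rw [mem_machineOf (isPrefixFreeGraph_universalGraph T)]
    refine ⟨(e, p), rfl, selected_of_exists ?_ ((he p b x).1 hp)⟩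
    rintro ⟨⟨q, y⟩, s⟩ hT hc
    have hq : y ∈ D q b := (he q b y).2 ⟨s, hT⟩
    rcases hc with hc | hc
    · obtain ⟨h1, h2⟩ := hD.isPrefixFreeGraph b q p y x hq hp hc
      rw [h1, h2]
    · obtain ⟨h1, h2⟩ := hD.isPrefixFreeGraph b p q x y hp hq hc
      rw [h1, h2]

theorem exists_isOptimalPrefixMachine_empty :
    ∃ U : List Bool → ℕ →. List Bool, IsOptimalPrefixMachine ∅ U := by
  let T : ℕ → ℕ → Candidate → Prop := fun e n y =>
    Code.evaln y.2 (Denumerable.ofNat Code e) (encode (y.1.1, n)) = some (encode y.1.2)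
  have hT : PrimrecPred fun x : (ℕ × ℕ) × Candidate => T x.1.1 x.1.2 x.2 := by
    refine Primrec.eq.comp (Code.primrec_evaln.comp (((Primrec.snd.comp Primrec.snd).pair
      ((Primrec.ofNat Code).comp (Primrec.fst.comp Primrec.fst))).pair (Primrec.encode.comp
        ((Primrec.fst.comp (Primrec.fst.comp Primrec.snd)).pair (Primrec.snd.comp Primrec.fst)))))
      (Primrec.option_some.comp (Primrec.encode.comp
        (Primrec.snd.comp (Primrec.fst.comp Primrec.snd))))
  refine ⟨_, isOptimalPrefixMachine_universalGraph (T := T) ?_ fun D hD => ?_⟩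
  · refine (partrec_of_isSigma1 ?_).recursiveIn
    have e : Primrec fun z : ((List Bool × ℕ) × List Bool) × (ℕ × List Bool) =>
        (((z.2.1, z.1.1.2), (z.2.2, z.1.2)) : (ℕ × ℕ) × (List Bool × List Bool)) :=
      ((Primrec.fst.comp Primrec.snd).pair
        (Primrec.snd.comp (Primrec.fst.comp Primrec.fst))).pair
      ((Primrec.snd.comp Primrec.snd).pair (Primrec.snd.comp Primrec.fst))
    refine (IsSigma1.exists' (P := fun z : ((List Bool × ℕ) × List Bool) × (ℕ × List Bool) =>
      z.1.1.1 = selfDelimit z.2.1 z.2.2 ∧ Selected (T z.2.1 z.1.1.2) z.2.2 z.1.2)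
      (IsSigma1.and_primrecPred (Primrec.eq.comp (Primrec.fst.comp (Primrec.fst.comp Primrec.fst))
        (primrec_selfDelimit.comp (Primrec.fst.comp Primrec.snd) (Primrec.snd.comp Primrec.snd)))
        ((isSigma1_selected (T := fun v : ℕ × ℕ => T v.1 v.2) hT).comp e))).of_eq fun z => ?_
    exact (mem_machineOf (isPrefixFreeGraph_universalGraph T) (p := z.1.1) (b := z.1.2)
      (x := z.2)).symm
  · obtain ⟨c, hc⟩ := exists_code_of_partrec (recursiveIn_empty_iff.1 hD.recursive)
    refine ⟨encode c, fun p b x => (hc (p, b) x).trans ?_⟩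
    simp only [Code.evaln_complete, Denumerable.ofNat_encode, T, Option.mem_def]

theorem exists_isOptimalPrefixMachine_zeroJump :
    ∃ V : List Bool → Unit →. List Bool, IsOptimalPrefixMachine {zeroJump} V := by
  let T : ℕ → Unit → Candidate → Prop := fun e _ y =>
    ¬ ((Denumerable.ofNat Code e).eval (encode y)).Dom
  refine ⟨_, isOptimalPrefixMachine_universalGraph (T := T) ?_ fun D hD => ?_⟩
  · refine recursiveIn_of_isSigma2 ?_
    have e : Primrec fun z : ((List Bool × Unit) × List Bool) × (ℕ × List Bool) =>
        ((z.2.1, (z.2.2, z.1.2)) : ℕ × (List Bool × List Bool)) :=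
      (Primrec.fst.comp Primrec.snd).pair
      ((Primrec.snd.comp Primrec.snd).pair (Primrec.snd.comp Primrec.fst))
    refine (IsSigma2.exists' (P := fun z : ((List Bool × Unit) × List Bool) × (ℕ × List Bool) =>
      z.1.1.1 = selfDelimit z.2.1 z.2.2 ∧ Selected (T z.2.1 ()) z.2.2 z.1.2)
      (IsSigma2.and (.of_primrecPred
        (Primrec.eq.comp (Primrec.fst.comp (Primrec.fst.comp Primrec.fst))
        (primrec_selfDelimit.comp (Primrec.fst.comp Primrec.snd) (Primrec.snd.comp Primrec.snd))))
        (isSigma2_selected_not_dom.comp e))).of_eq fun z => ?_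
    exact (mem_machineOf (isPrefixFreeGraph_universalGraph T) (p := z.1.1) (b := z.1.2)
      (x := z.2)).symm
  · obtain ⟨c, hc⟩ := exists_code_of_isSigma2 ((isSigma2_graph_of_recursiveIn hD.recursive).comp
      (f := fun v : List Bool × List Bool => ((v.1, ()), v.2))
      ((Primrec.fst.pair (Primrec.const ())).pair Primrec.snd))
    refine ⟨encode c, fun p b x => (hc (p, x)).trans ?_⟩
    simp only [Denumerable.ofNat_encode, T]

/-! ### The upper bound -/

theorem limsup_complexity_le {U : List Bool → ℕ →. List Bool} {V : List Bool → Unit →. List Bool}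
    (hU : IsOptimalPrefixMachine ∅ U) (hV : IsPrefixMachine {zeroJump} V) :
    ∃ c : ℕ, ∀ x, limsup (fun n : ℕ => complexity U x n) atTop ≤ complexity V x () + c := by
  obtain ⟨c, hc⟩ := exists_code_of_isSigma2 ((isSigma2_graph_of_recursiveIn hV.recursive).comp
    (f := fun v : List Bool × List Bool => ((v.1, ()), v.2))
    ((Primrec.fst.pair (Primrec.const ())).pair Primrec.snd))
  replace hc : ∀ p x, x ∈ V p () ↔ ∃ s : ℕ, ¬ (c.eval (encode ((p, x), s))).Dom :=
    fun p x => hc (p, x)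
  let T : ℕ → Candidate → Prop := fun n y => Code.evaln n c (encode y) = none
  let G : List Bool → ℕ → List Bool → Prop := fun p n x => Selected (T n) p x
  have hG : IsPrefixFreeGraph G := fun n p q x y hx hy h => hx.eq_of_prefix hy h
  have hT : PrimrecPred fun x : ℕ × Candidate => T x.1 x.2 :=
    Primrec.eq.comp (Code.primrec_evaln.comp ((Primrec.fst.pair (Primrec.const c)).pair
      (Primrec.encode.comp Primrec.snd))) (Primrec.const none)
  have hrec : RecursiveIn₂ ∅ (machineOf G) := by
    refine (partrec_of_isSigma1 ?_).recursiveIn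
    refine ((isSigma1_selected hT).comp (f := fun z : (List Bool × ℕ) × List Bool =>
      (z.1.2, (z.1.1, z.2))) ((Primrec.snd.comp Primrec.fst).pair
        ((Primrec.fst.comp Primrec.fst).pair Primrec.snd))).of_eq fun z => ?_
    exact (mem_machineOf hG).symm
  obtain ⟨d, hd⟩ := hU.optimal _ (isPrefixMachine_machineOf hG hrec)
  refine ⟨d, fun x => ?_⟩
  rcases eq_or_ne (complexity V x ()) ⊤ with htop | htop
  · simp [htop]
  lift complexity V x () to ℕ using htop with m hm
  obtain ⟨p, hp, hpm⟩ := exists_program hm.symm.le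
  have hev : ∀ᶠ n : ℕ in atTop, Selected (T n) p x := by
    -- The least candidate that is never refuted; it is alive at every `n`.
    obtain ⟨s, hs, hmin⟩ := exists_isLeast_candidate
      (T := fun y => ¬ (c.eval (encode y)).Dom) ((hc p x).1 hp)
    have hstage : ∀ w, ∃ N, (c.eval w).Dom → ∀ n ≥ N, Code.evaln n c w ≠ none := by
      intro w
      by_cases hw : (c.eval w).Dom
      · obtain ⟨z, hz⟩ := Part.dom_iff_mem.1 hw
        obtain ⟨N, hN⟩ := Code.evaln_complete.1 hz
        refine ⟨N, fun _ n hn h => ?_⟩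
        have := Code.evaln_mono hn hN
        simp [h] at this
      · exact ⟨0, fun h => absurd h hw⟩
    choose N hN using hstage
    -- By this stage every halting computation on a code below that of `((p, x), s)` has been seen
    -- to halt.
    filter_upwards [eventually_ge_atTop
      ((Finset.range (encode (((p, x), s) : Candidate))).sup N)] with n hn
    refine ⟨s, ?_, fun y hy hcomp hT => ?_⟩
    · refine Option.eq_none_iff_forall_not_mem.2 fun z hz => hs ?_
      exact Part.dom_iff_mem.2 ⟨z, Code.evaln_sound hz⟩
    · have hNn : N (encode y) ≤ n :=
        (Finset.le_sup (f := N) (Finset.mem_range.2 hy)).trans hn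
      have hnd : ¬ (c.eval (encode y)).Dom := fun hd => hN _ hd n hNn hT
      obtain ⟨⟨q, z⟩, r⟩ := y
      -- A smaller comparable survivor is a true candidate, so prefix-freeness of `V` gives it the
      -- same program and output, against minimality.
      have hq : z ∈ V q () := (hc q z).2 ⟨r, hnd⟩
      obtain ⟨rfl, rfl⟩ : q = p ∧ z = x := by
        rcases hcomp with h | h
        · exact hV.isPrefixFreeGraph () q p z x hq hp h
        · obtain ⟨h1, h2⟩ := hV.isPrefixFreeGraph () p q x z hp hq h
          exact ⟨h1.symm, h2.symm⟩
      exact hmin r hy hnd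
  refine limsup_le_of_le (h := ?_)
  filter_upwards [hev] with n hn
  refine (hd x n).trans ?_
  have := complexity_le ((mem_machineOf hG).2 hn)
  gcongr
  refine this.trans ?_
  exact_mod_cast hpm

/-! ### The Kraft inequality -/

theorem uniquelyDecodable_of_prefixFree {S : Set (List Bool)} (hne : [] ∉ S)
    (hS : ∀ p ∈ S, ∀ q ∈ S, p <+: q → p = q) : InformationTheory.UniquelyDecodable S := by
  intro L₁
  induction L₁ with
  | nil =>
    intro L₂ _ h₂ h
    cases L₂ with
    | nil => rfl
    | cons q L =>
      simp only [List.flatten_nil, List.flatten_cons, List.nil_eq, List.append_eq_nil_iff] at h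
      exact absurd (h.1 ▸ h₂ q (by simp)) hne
  | cons p L ih =>
    intro L₂ h₁ h₂ h
    cases L₂ with
    | nil =>
      simp only [List.flatten_nil, List.flatten_cons, List.append_eq_nil_iff] at h
      exact absurd (h.1 ▸ h₁ p (by simp)) hne
    | cons q M =>
      simp only [List.flatten_cons] at h
      have hpq : p = q := by
        rcases List.prefix_or_prefix_of_prefix (List.prefix_append p L.flatten)
          (h ▸ List.prefix_append q M.flatten) with h' | h'
        · exact hS p (h₁ p (by simp)) q (h₂ q (by simp)) h'
        · exact (hS q (h₂ q (by simp)) p (h₁ p (by simp)) h').symm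
      subst hpq
      rw [ih M (fun w hw => h₁ w (by simp [hw])) (fun w hw => h₂ w (by simp [hw]))
        (List.append_cancel_left h)]

/-- The total weight `∑ 2⁻ᵏ` of a list of lengths. -/
noncomputable def weight (l : List ℕ) : ℝ := (l.map fun k => (1 / 2 : ℝ) ^ k).sum

theorem weight_cons (k : ℕ) (l : List ℕ) : weight (k :: l) = (1 / 2) ^ k + weight l := by
  simp [weight]

theorem weight_nonneg (l : List ℕ) : 0 ≤ weight l :=
  List.sum_nonneg (by simp only [List.mem_map]; rintro _ ⟨k, -, rfl⟩; positivity)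

theorem weight_le_of_suffix {l m : List ℕ} (h : l <:+ m) : weight l ≤ weight m := by
  obtain ⟨r, rfl⟩ := h
  have := weight_nonneg r
  simp only [weight, List.map_append, List.sum_append] at this ⊢
  linarith

/-- A description length `k` requested for a string `x`. -/
abbrev Request : Type := List Bool × ℕ

/-- A request `(x, k)` with a program `p` for `x` of length at most `k` is sent to the word `p 1ᵈ 0`
of length `k + 1`, where `d = k - |p|`. These words form a prefix-free set, so Kraft bounds the sum
of `2^(-k-1)` by 1. The final `0` separates different `k` and keeps the words nonempty. -/
theorem weight_le_two {β : Type} {D : List Bool → β →. List Bool} {b : β}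
    (hD : IsPrefixFreeGraph fun p b x => x ∈ D p b) {F : List Request} (hF : F.Nodup)
    (h : ∀ f ∈ F, ∃ p, f.1 ∈ D p b ∧ p.length ≤ f.2) : weight (F.map Prod.snd) ≤ 2 := by
  classical
  choose! p hp hlen using h
  let w : Request → List Bool := fun f => p f ++ selfDelimit (f.2 - (p f).length) []
  have hw : ∀ f ∈ F, ∀ g ∈ F, w f <+: w g → f = g := by
    intro f hf g hg h
    have hcomp : p f = p g ∧ f.1 = g.1 := by
      rcases List.prefix_or_prefix_of_prefix ((List.prefix_append _ _).trans h)
        (List.prefix_append (p g) (selfDelimit (g.2 - (p g).length) [])) with h' | h'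
      · exact hD b _ _ _ _ (hp f hf) (hp g hg) h'
      · exact (hD b _ _ _ _ (hp g hg) (hp f hf) h').imp Eq.symm Eq.symm
    have hlen' : f.2 - (p f).length = g.2 - (p g).length := by
      simp only [w, hcomp.1, List.prefix_append_right_inj] at h
      rw [hcomp.1]
      exact (eq_of_selfDelimit_prefix h).1
    have h1 := hlen f hf
    have h2 := hlen g hg
    rw [hcomp.1] at h1 hlen'
    exact Prod.ext hcomp.2 (by omega)
  have hinj : Set.InjOn w (F.toFinset : Set Request) := fun f hf g hg h =>
    hw f (by simpa using hf) g (by simpa using hg) (h ▸ List.prefix_refl _)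
  have hk := InformationTheory.kraft_mcmillan_inequality (S := F.toFinset.image w)
    (uniquelyDecodable_of_prefixFree ?_ ?_)
  · rw [Finset.sum_image hinj] at hk
    have hsum : ∑ f ∈ F.toFinset, (1 / (Fintype.card Bool : ℝ)) ^ (w f).length =
        ∑ f ∈ F.toFinset, (1 / 2 : ℝ) ^ f.2 * (1 / 2) := by
      refine Finset.sum_congr rfl fun f hf => ?_
      have h1 := hlen f (by simpa using hf)
      have h2 : (w f).length = f.2 + 1 := by
        simp only [w, List.length_append, length_selfDelimit, List.length_nil]
        omega
      rw [h2, pow_succ]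
      simp
    rw [hsum, ← Finset.sum_mul, List.sum_toFinset _ hF] at hk
    rw [weight, List.map_map]
    have : ((F.map ((fun k => (1 / 2 : ℝ) ^ k) ∘ Prod.snd)).sum) =
      (F.map fun f => (1 / 2 : ℝ) ^ f.2).sum := rfl
    rw [this]
    linarith
  · simp [w, selfDelimit]
  · intro q hq r hr h
    simp only [Finset.coe_image, Set.mem_image, List.coe_toFinset, Set.mem_ofPred_eq] at hq hr
    obtain ⟨f, hf, rfl⟩ := hq
    obtain ⟨g, hg, rfl⟩ := hr
    rw [hw f hf g hg h]

/-! ### Weights as fractions -/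

/-- Numerator and denominator of the weight of a list. -/
def weightFrac (l : List ℕ) : ℕ × ℕ :=
  l.foldr (fun k v => (v.2 + 2 ^ k * v.1, 2 ^ k * v.2)) (0, 1)

theorem weightFrac_snd_pos (l : List ℕ) : 0 < (weightFrac l).2 := by
  induction l with
  | nil => simp [weightFrac]
  | cons k l ih => exact Nat.mul_pos (by positivity) ih

/-- With integer numerators and denominators, comparisons of weights become primitive recursive. -/
theorem weight_eq_div (l : List ℕ) : weight l = (weightFrac l).1 / (weightFrac l).2 := by
  induction l with
  | nil => simp [weight, weightFrac]
  | cons k l ih =>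
    have h : (0 : ℝ) < (weightFrac l).2 := by exact_mod_cast weightFrac_snd_pos l
    have e1 : (weightFrac (k :: l)).1 = (weightFrac l).2 + 2 ^ k * (weightFrac l).1 := rfl
    have e2 : (weightFrac (k :: l)).2 = 2 ^ k * (weightFrac l).2 := rfl
    rw [weight_cons, ih, e1, e2]
    push_cast
    rw [one_div, inv_pow]
    field_simp

theorem primrec_two_pow : Primrec fun k : ℕ => 2 ^ k :=
  (Primrec₂.unpaired'.1 Nat.Primrec.pow).comp (Primrec.const 2) Primrec.id

theorem primrec_weightFrac : Primrec weightFrac := by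
  have hk : Primrec fun z : List ℕ × (ℕ × (ℕ × ℕ)) => 2 ^ z.2.1 :=
    primrec_two_pow.comp (Primrec.fst.comp Primrec.snd)
  have h1 : Primrec fun z : List ℕ × (ℕ × (ℕ × ℕ)) => z.2.2.1 :=
    Primrec.fst.comp (Primrec.snd.comp Primrec.snd)
  have h2 : Primrec fun z : List ℕ × (ℕ × (ℕ × ℕ)) => z.2.2.2 :=
    Primrec.snd.comp (Primrec.snd.comp Primrec.snd)
  exact Primrec.list_foldr (h := fun (_ : List ℕ) (z : ℕ × (ℕ × ℕ)) =>
      (z.2.2 + 2 ^ z.1 * z.2.1, 2 ^ z.1 * z.2.2)) Primrec.id (Primrec.const (0, 1))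
    ((Primrec.nat_add.comp h2 (Primrec.nat_mul.comp hk h1)).pair (Primrec.nat_mul.comp hk h2))

/-! ### Strings as dyadic intervals -/

/-- The number with the binary expansion `p`. -/
def binVal (p : List Bool) : ℕ := p.foldl (fun v b => 2 * v + b.toNat) 0

theorem primrec_binVal : Primrec binVal := by
  refine Primrec.list_foldl (h := fun (_ : List Bool) (z : ℕ × Bool) => 2 * z.1 + z.2.toNat)
    Primrec.id (Primrec.const 0) (Primrec.nat_add.comp ?_ ?_)
  · exact Primrec.nat_mul.comp (Primrec.const 2) (Primrec.fst.comp Primrec.snd)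
  · exact (Primrec.dom_bool Bool.toNat).comp (Primrec.snd.comp Primrec.snd)

theorem binVal_concat (p : List Bool) (b : Bool) : binVal (p ++ [b]) = 2 * binVal p + b.toNat := by
  simp [binVal]

theorem binVal_append_bounds (p r : List Bool) :
    binVal p * 2 ^ r.length ≤ binVal (p ++ r) ∧
      binVal (p ++ r) + 1 ≤ (binVal p + 1) * 2 ^ r.length := by
  induction r using List.reverseRecOn with
  | nil => simp
  | append_singleton r b ih =>
    rw [← List.append_assoc, binVal_concat, List.length_append, List.length_singleton, pow_succ]
    have := b.toNat_le
    constructor <;> nlinarith [ih.1, ih.2]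

theorem exists_binVal_eq (m : ℕ) : ∀ a < 2 ^ m, ∃ p : List Bool, p.length = m ∧ binVal p = a := by
  induction m with
  | zero => intro a ha; exact ⟨[], rfl, by simp at ha; simp [binVal, ha]⟩
  | succ m ih =>
    intro a ha
    obtain ⟨p, hp, hpa⟩ := ih (a / 2) (by rw [pow_succ] at ha; omega)
    refine ⟨p ++ [a.bodd], by simp [hp], ?_⟩
    rw [binVal_concat, hpa]
    have := Nat.bodd_add_div2 a
    rw [Nat.div2_val] at this
    cases h : a.bodd <;> simp [h] at this ⊢ <;> omega

/-- The dyadic interval of `p` lies in the half-scale copy of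
`[weight l, weight l + 2⁻ᵏ)`, and `p` has length `k + 2`. -/
def Fits (p : List Bool) (k : ℕ) (l : List ℕ) : Prop :=
  p.length = k + 2 ∧ weight l * 2 ^ (k + 1) ≤ binVal p ∧
    (binVal p : ℝ) + 1 ≤ weight l * 2 ^ (k + 1) + 2

/-- Halving the scale puts total weight 2 into the unit interval and leaves length `2^(-k-1)` for
the request. An interval twice as long as the dyadic step `2^(-k-2)` contains an aligned one, found
by rounding the left end up. -/
theorem exists_fits {k : ℕ} {l : List ℕ} (h : weight (k :: l) ≤ 2) : ∃ p, Fits p k l := by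
  have h0 : 0 ≤ weight l * 2 ^ (k + 1) := mul_nonneg (weight_nonneg l) (by positivity)
  have hlt := Nat.ceil_lt_add_one h0
  have hb : (⌈weight l * 2 ^ (k + 1)⌉₊ : ℝ) < 2 ^ (k + 2) := by
    rw [weight_cons] at h
    have e : ((1 / 2) ^ k + weight l) * 2 ^ (k + 1) = 2 + weight l * 2 ^ (k + 1) := by
      rw [add_mul, one_div, inv_pow, pow_succ]
      field_simp
    have : ((1 / 2) ^ k + weight l) * 2 ^ (k + 1) ≤ 2 * 2 ^ (k + 1) := by gcongr
    rw [e] at this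
    rw [show k + 2 = k + 1 + 1 from rfl, pow_succ _ (k + 1)]
    linarith
  obtain ⟨p, hp, hpv⟩ := exists_binVal_eq (k + 2) ⌈weight l * 2 ^ (k + 1)⌉₊ (by exact_mod_cast hb)
  refine ⟨p, hp, ?_, ?_⟩
  · rw [hpv]
    exact Nat.le_ceil _
  · rw [hpv]
    linarith

theorem Fits.bounds {p : List Bool} {k : ℕ} {l : List ℕ} (h : Fits p k l) :
    weight l / 2 ≤ binVal p / 2 ^ p.length ∧
      ((binVal p : ℝ) + 1) / 2 ^ p.length ≤ weight (k :: l) / 2 := by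
  obtain ⟨h1, h2, h3⟩ := h
  rw [h1, weight_cons]
  have e : (2 : ℝ) ^ (k + 2) = 2 ^ (k + 1) * 2 := by ring
  have e' : (2 : ℝ) ^ (k + 1) = 2 ^ k * 2 := by ring
  have hpos : (0 : ℝ) < 2 ^ (k + 1) := by positivity
  constructor
  · rw [le_div_iff₀ (by positivity), e]
    linarith
  · rw [div_le_iff₀ (by positivity), e]
    have : (1 / 2 : ℝ) ^ k * 2 ^ (k + 1) = 2 := by
      rw [one_div, inv_pow, e']
      field_simp
    linarith [add_mul ((1 / 2 : ℝ) ^ k) (weight l) (2 ^ (k + 1))]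

theorem interval_subset_of_prefix {p q : List Bool} (h : p <+: q) :
    (binVal p : ℝ) / 2 ^ p.length ≤ binVal q / 2 ^ q.length ∧
      ((binVal q : ℝ) + 1) / 2 ^ q.length ≤ (binVal p + 1) / 2 ^ p.length := by
  obtain ⟨r, rfl⟩ := h
  obtain ⟨h1, h2⟩ := binVal_append_bounds p r
  have h1' : (binVal p : ℝ) * 2 ^ r.length ≤ binVal (p ++ r) := by exact_mod_cast h1
  have h2' : (binVal (p ++ r) : ℝ) + 1 ≤ (binVal p + 1) * 2 ^ r.length := by exact_mod_cast h2
  rw [List.length_append, pow_add]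
  constructor <;> rw [div_le_div_iff₀ (by positivity) (by positivity)]
  · calc _ = (binVal p : ℝ) * 2 ^ r.length * 2 ^ p.length := by ring
      _ ≤ _ := by gcongr
  · calc _ ≤ ((binVal p : ℝ) + 1) * 2 ^ r.length * 2 ^ p.length := by gcongr
      _ = _ := by ring

/-- The two words lie in disjoint slots, while a prefix relation would make one dyadic interval
contain the other. -/
theorem not_comparable_of_fits {p q : List Bool} {k j : ℕ} {l m : List ℕ} (hp : Fits p k l)
    (hq : Fits q j m) (h : weight (k :: l) ≤ weight m) : ¬ p <+: q ∧ ¬ q <+: p := by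
  have hp' := hp.bounds.2
  have hq' := hq.bounds.1
  have hlt : ∀ r : List Bool, (binVal r : ℝ) / 2 ^ r.length < (binVal r + 1) / 2 ^ r.length :=
    fun r => by gcongr; linarith
  constructor <;> intro hpq
  · have := (interval_subset_of_prefix hpq).2
    have := hlt q
    linarith
  · have := (interval_subset_of_prefix hpq).1
    have := hlt p
    linarith

theorem primrecPred_fits :
    PrimrecPred fun z : List Bool × ℕ × List ℕ => Fits z.1 z.2.1 z.2.2 := by
  have hk : Primrec fun z : List Bool × ℕ × List ℕ => z.2.1 := Primrec.fst.comp Primrec.snd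
  have hw : Primrec fun z : List Bool × ℕ × List ℕ => weightFrac z.2.2 :=
    primrec_weightFrac.comp (Primrec.snd.comp Primrec.snd)
  have hv : Primrec fun z : List Bool × ℕ × List ℕ => (weightFrac z.2.2).2 := Primrec.snd.comp hw
  have hb : Primrec fun z : List Bool × ℕ × List ℕ => binVal z.1 :=
    primrec_binVal.comp Primrec.fst
  have hu : Primrec fun z : List Bool × ℕ × List ℕ => (weightFrac z.2.2).1 * 2 ^ (z.2.1 + 1) :=
    Primrec.nat_mul.comp (Primrec.fst.comp hw) (primrec_two_pow.comp (Primrec.succ.comp hk))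
  refine ((Primrec.eq.comp (Primrec.list_length.comp Primrec.fst)
    (Primrec.nat_add.comp hk (Primrec.const 2))).and
    ((Primrec.nat_le.comp hu (Primrec.nat_mul.comp hb hv)).and
      (Primrec.nat_le.comp (Primrec.nat_mul.comp (Primrec.succ.comp hb) hv)
        (Primrec.nat_add.comp hu (Primrec.nat_mul.comp (Primrec.const 2) hv))))).of_eq fun z => ?_
  have hpos : (0 : ℝ) < (weightFrac z.2.2).2 := by exact_mod_cast weightFrac_snd_pos _
  refine and_congr_right fun _ => and_congr ?_ ?_
  · rw [weight_eq_div, div_mul_eq_mul_div, div_le_iff₀ hpos]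
    norm_cast
  · rw [weight_eq_div, div_mul_eq_mul_div, div_add' _ _ _ hpos.ne', le_div_iff₀ hpos]
    norm_cast

theorem primrecPred_nodup {α : Type} [Primcodable α] : PrimrecPred fun l : List α => l.Nodup := by
  have h : PrimrecPred fun l : List α => ∀ j < l.length, ∀ i < j, l[i]? ≠ l[j]? := by
    refine primrecPred_forall_lt (R := fun z : List α × ℕ => ∀ i < z.2, z.1[i]? ≠ z.1[z.2]?) ?_
      Primrec.list_length
    refine primrecPred_forall_lt (R := fun z : (List α × ℕ) × ℕ =>
      z.1.1[z.2]? ≠ z.1.1[z.1.2]?) (PrimrecPred.not (Primrec.eq.comp ?_ ?_)) Primrec.snd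
    · exact Primrec.list_getElem?.comp (Primrec.fst.comp Primrec.fst) Primrec.snd
    · exact Primrec.list_getElem?.comp (Primrec.fst.comp Primrec.fst)
        (Primrec.snd.comp Primrec.fst)
  refine h.of_eq fun l => ?_
  rw [List.nodup_iff_getElem?_ne_getElem?]
  exact ⟨fun h i j hij hj => h j hj i hij, fun h j hj i hij => h i j hij hj⟩

/-! ### Greedy acceptance of requests -/

/-- A request that is to be satisfied under all conditions from some `N` on. -/
abbrev Item : Type := Request × ℕ

/-- Adding the requests in `L` to the families `E n` either repeats a request or makes the weight
of some family exceed 2. -/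
def Refused (E : ℕ → Request → Prop) (L : List Item) : Prop :=
  ¬ (L.map Prod.fst).Nodup ∨ ∃ n, ∃ F : List Request, F.Nodup ∧
    (∀ f ∈ F, E n f ∨ ∃ i ∈ L, i.1 = f ∧ i.2 ≤ n) ∧ 2 < weight (F.map Prod.snd)

/-- One step of the greedy procedure: accept the `i`-th item unless it has to be refused. -/
noncomputable def greedyStep (E : ℕ → Request → Prop) (i : ℕ) (L : List Item) : List Item :=
  open Classical in
  match decode (α := Item) i with
  | none => L
  | some a => if Refused E (a :: L) then L else a :: L

/-- The list of items accepted among the first `i` ones, the latest first. -/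
noncomputable def greedy (E : ℕ → Request → Prop) (i : ℕ) : List Item :=
  Nat.rec [] (greedyStep E) i

section Greedy

variable {E : ℕ → Request → Prop}

theorem greedyStep_cases (i : ℕ) (L : List Item) : greedyStep E i L = L ∨
    ∃ a, ¬ Refused E (a :: L) ∧ greedyStep E i L = a :: L := by
  unfold greedyStep
  split
  · exact Or.inl rfl
  · rename_i a _
    split_ifs with h
    · exact Or.inl rfl
    · exact Or.inr ⟨a, h, rfl⟩

theorem greedy_succ (i : ℕ) : greedy E (i + 1) = greedyStep E i (greedy E i) := rfl

theorem greedy_suffix {i j : ℕ} (h : i ≤ j) : greedy E i <:+ greedy E j := by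
  induction j, h using Nat.le_induction with
  | base => exact List.suffix_refl _
  | succ j _ ih =>
    rw [greedy_succ]
    rcases greedyStep_cases (E := E) j (greedy E j) with h | ⟨a, -, h⟩ <;> rw [h]
    · exact ih
    · exact ih.trans (List.suffix_cons _ _)

theorem exists_greedy_eq_cons {j : ℕ} {a : Item} (h : a ∈ greedy E j) :
    ∃ i L, greedy E i = a :: L := by
  induction j with
  | zero => simp [greedy] at h
  | succ j ih =>
    rcases greedyStep_cases (E := E) j (greedy E j) with h' | ⟨b, -, h'⟩
    · rw [greedy_succ, h'] at h
      exact ih h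
    · have h'' := h
      rw [greedy_succ, h', List.mem_cons] at h''
      rcases h'' with rfl | h''
      · exact ⟨j + 1, greedy E j, h'⟩
      · exact ih h''

/-- The invariant holds at the start because each `E n` by itself has weight at most 2. -/
theorem not_refused_greedy (hE : ∀ n (F : List Request), F.Nodup → (∀ f ∈ F, E n f) →
    weight (F.map Prod.snd) ≤ 2) (i : ℕ) : ¬ Refused E (greedy E i) := by
  induction i with
  | zero =>
    rintro (h | ⟨n, F, hF, h, h2⟩)
    · exact h (by simp [greedy])
    · exact h2.not_ge (hE n F hF fun f hf => by simpa [greedy] using h f hf)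
  | succ i ih =>
    rw [greedy_succ]
    rcases greedyStep_cases (E := E) i (greedy E i) with h | ⟨a, ha, h⟩ <;> rwa [h]

theorem weight_le_two_of_not_refused {L : List Item} (h : ¬ Refused E L) :
    weight (L.map fun i => i.1.2) ≤ 2 := by
  rw [Refused, not_or, not_not] at h
  obtain ⟨hnd, h⟩ := h
  by_contra! hlt
  -- The sum of all thresholds is at least each of them, so under this condition every accepted
  -- request is active at once.
  refine h ⟨(L.map Prod.snd).sum, L.map Prod.fst, hnd, fun f hf => Or.inr ?_, ?_⟩
  · obtain ⟨i, hi, rfl⟩ := List.mem_map.1 hf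
    exact ⟨i, hi, rfl, List.single_le_sum (by simp) _ (List.mem_map_of_mem hi)⟩
  · rwa [List.map_map]

/-- The true item `(r, N)` adds nothing to any `E n`, so it cannot cause an overflow and is refused
only as a repetition. The threshold `M` of the accepted item may therefore differ from `N`. -/
theorem exists_greedy_eq_cons_of_eventually (hE : ∀ n (F : List Request), F.Nodup →
    (∀ f ∈ F, E n f) → weight (F.map Prod.snd) ≤ 2) {r : Request} {N : ℕ}
    (h : ∀ n ≥ N, E n r) : ∃ i M L, greedy E i = (r, M) :: L := by
  suffices ∃ j, ∃ a ∈ greedy E j, a.1 = r by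
    obtain ⟨j, a, ha, rfl⟩ := this
    obtain ⟨i, L, hL⟩ := exists_greedy_eq_cons ha
    exact ⟨i, a.2, L, hL⟩
  have hi := not_refused_greedy hE (encode ((r, N) : Item))
  have hstep := greedy_succ (E := E) (encode ((r, N) : Item))
  by_cases hr : Refused E ((r, N) :: greedy E (encode ((r, N) : Item)))
  · rcases hr with hr | ⟨n, F, hF, hF', h2⟩
    · rw [Refused, not_or, not_not] at hi
      rw [List.map_cons, List.nodup_cons, not_and_or, not_not, or_iff_left (not_not.2 hi.1)] at hr
      obtain ⟨a, ha, har⟩ := List.mem_map.1 hr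
      exact ⟨_, a, ha, har⟩
    · refine absurd (Or.inr ⟨n, F, hF, fun f hf => ?_, h2⟩) hi
      rcases hF' f hf with h' | ⟨i, hi, rfl, hin⟩
      · exact Or.inl h'
      · rcases List.mem_cons.1 hi with rfl | hi
        · exact Or.inl (h n hin)
        · exact Or.inr ⟨i, hi, rfl, hin⟩
  · refine ⟨encode ((r, N) : Item) + 1, (r, N), ?_, rfl⟩
    rw [hstep, greedyStep, encodek]
    simp only [if_neg hr, List.mem_cons_self]

/-! ### Complexity of the greedy procedure -/

/-- An overflow is certified by a finite object: a condition and a list of requests, each with a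
witness for its membership in `E n`. -/
theorem isSigma1_refused (hE : IsSigma1 fun z : ℕ × Request => E z.1 z.2) :
    IsSigma1 (Refused E) := by
  obtain ⟨R, hR, hE⟩ := hE
  have hL : Primrec fun z : List Item × (ℕ × List (Request × ℕ)) => z.1 := Primrec.fst
  have hG : Primrec fun z : List Item × (ℕ × List (Request × ℕ)) => z.2.2.map Prod.fst :=
    Primrec.list_map (Primrec.snd.comp Primrec.snd) (Primrec.fst.comp Primrec.snd).to₂
  have hw : Primrec fun z : List Item × (ℕ × List (Request × ℕ)) =>
      weightFrac ((z.2.2.map Prod.fst).map Prod.snd) :=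
    primrec_weightFrac.comp (Primrec.list_map hG (Primrec.snd.comp Primrec.snd).to₂)
  refine (IsSigma1.of_exists (R := fun z : List Item × (ℕ × List (Request × ℕ)) =>
    (¬ (z.1.map Prod.fst).Nodup) ∨ ((z.2.2.map Prod.fst).Nodup ∧
      (∀ g ∈ z.2.2, R ((z.2.1, g.1), g.2) ∨ ∃ i ∈ z.1, i.1 = g.1 ∧ i.2 ≤ z.2.1) ∧
      2 * (weightFrac ((z.2.2.map Prod.fst).map Prod.snd)).2 <
        (weightFrac ((z.2.2.map Prod.fst).map Prod.snd)).1))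
    (PrimrecPred.or ?_ (PrimrecPred.and ?_ (PrimrecPred.and ?_ ?_)))).of_eq fun L => ?_
  · exact (primrecPred_nodup.comp
      (Primrec.list_map hL (Primrec.fst.comp Primrec.snd).to₂)).not
  · exact primrecPred_nodup.comp hG
  · refine primrecPred_forall_mem
      (R := fun z : (List Item × (ℕ × List (Request × ℕ))) × (Request × ℕ) =>
        R ((z.1.2.1, z.2.1), z.2.2) ∨ ∃ i ∈ z.1.1, i.1 = z.2.1 ∧ i.2 ≤ z.1.2.1)
      (PrimrecPred.or (hR.comp ?_) ?_) (Primrec.snd.comp Primrec.snd)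
    · exact ((Primrec.fst.comp (Primrec.snd.comp Primrec.fst)).pair
        (Primrec.fst.comp Primrec.snd)).pair (Primrec.snd.comp Primrec.snd)
    · refine primrecPred_exists_mem
        (R := fun z : ((List Item × (ℕ × List (Request × ℕ))) × (Request × ℕ)) × Item =>
          z.2.1 = z.1.2.1 ∧ z.2.2 ≤ z.1.1.2.1) (PrimrecPred.and ?_ ?_)
        (Primrec.fst.comp Primrec.fst)
      · exact Primrec.eq.comp (Primrec.fst.comp Primrec.snd)
          (Primrec.fst.comp (Primrec.snd.comp Primrec.fst))
      · exact Primrec.nat_le.comp (Primrec.snd.comp Primrec.snd)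
          (Primrec.fst.comp (Primrec.snd.comp (Primrec.fst.comp Primrec.fst)))
  · exact Primrec.nat_lt.comp (Primrec.nat_mul.comp (Primrec.const 2) (Primrec.snd.comp hw))
      (Primrec.fst.comp hw)
  · have hlt : ∀ l : List ℕ, 2 * (weightFrac l).2 < (weightFrac l).1 ↔ 2 < weight l := fun l => by
      have hpos : (0 : ℝ) < (weightFrac l).2 := by exact_mod_cast weightFrac_snd_pos _
      rw [weight_eq_div, lt_div_iff₀ hpos]
      norm_cast
    simp only [hlt]
    constructor
    · rintro ⟨⟨n, G⟩, h | ⟨hnd, hG, h2⟩⟩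
      · exact Or.inl h
      · refine Or.inr ⟨n, G.map Prod.fst, hnd, fun f hf => ?_, h2⟩
        obtain ⟨g, hg, rfl⟩ := List.mem_map.1 hf
        exact (hG g hg).imp_left fun h => (hE (n, g.1)).2 ⟨_, h⟩
    · rintro (h | ⟨n, F, hnd, hF, h2⟩)
      -- A repetition needs no certificate, so the pair is arbitrary.
      · exact ⟨(0, []), Or.inl h⟩
      · have : ∀ f, ∃ s, E n f → R ((n, f), s) := fun f => by
          by_cases hf : E n f
          · obtain ⟨s, hs⟩ := (hE (n, f)).1 hf
            exact ⟨s, fun _ => hs⟩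
          · exact ⟨0, fun h => absurd h hf⟩
        choose s hs using this
        have hmap : (F.map fun f => (f, s f)).map Prod.fst = F := by
          rw [List.map_map]
          exact List.map_id F
        refine ⟨(n, F.map fun f => (f, s f)), Or.inr ⟨by rwa [hmap], fun g hg => ?_, by rwa [hmap]⟩⟩
        obtain ⟨f, hf, rfl⟩ := List.mem_map.1 hg
        exact (hF f hf).imp_left (hs f)

/-- Each step branches on a Σ₁ condition or its negation, both of which are Σ₂. -/
theorem isSigma2_greedy (hE : IsSigma1 fun z : ℕ × Request => E z.1 z.2) :
    IsSigma2 fun z : ℕ × List Item => greedy E z.1 = z.2 := by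
  have hstep : IsSigma2 fun z : (Unit × ℕ × List Item) × List Item =>
      greedyStep E z.1.2.1 z.1.2.2 = z.2 := by
    have hi : Primrec fun z : (Unit × ℕ × List Item) × List Item => decode (α := Item) z.1.2.1 :=
      Primrec.decode.comp (Primrec.fst.comp (Primrec.snd.comp Primrec.fst))
    have hL : Primrec fun z : (Unit × ℕ × List Item) × List Item => z.1.2.2 :=
      Primrec.snd.comp (Primrec.snd.comp Primrec.fst)
    have hc : Primrec fun v : ((Unit × ℕ × List Item) × List Item) × Item => v.2 :: v.1.1.2.2 :=
      Primrec.list_cons.comp Primrec.snd (hL.comp Primrec.fst)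
    have hr := (isSigma1_refused hE).comp hc
    refine ((IsSigma2.of_primrecPred ((Primrec.eq.comp hi (Primrec.const none)).and
      (Primrec.eq.comp hL Primrec.snd))).or (IsSigma2.exists'
        (P := fun v : ((Unit × ℕ × List Item) × List Item) × Item =>
          decode (α := Item) v.1.1.2.1 = some v.2 ∧
            ((Refused E (v.2 :: v.1.1.2.2) ∧ v.1.1.2.2 = v.1.2) ∨
              (¬ Refused E (v.2 :: v.1.1.2.2) ∧ v.2 :: v.1.1.2.2 = v.1.2)))
        (.and (.of_primrecPred (Primrec.eq.comp (hi.comp Primrec.fst)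
          (Primrec.option_some.comp Primrec.snd)))
          (.or (.and (.of_isSigma1 hr)
            (.of_primrecPred (Primrec.eq.comp (hL.comp Primrec.fst)
              (Primrec.snd.comp Primrec.fst))))
            (.and (.of_not_isSigma1 hr)
              (.of_primrecPred (Primrec.eq.comp hc (Primrec.snd.comp Primrec.fst)))))))).of_eq
      fun z => ?_
    unfold greedyStep
    dsimp only
    generalize decode (α := Item) z.1.2.1 = o
    cases o with
    | none => simp
    | some a => by_cases hr : Refused E (a :: z.1.2.2) <;> simp [hr]
  refine ((IsSigma2.path (F := fun z : Unit × List Item => z.2 = [])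
    (.of_primrecPred (Primrec.eq.comp Primrec.snd (Primrec.const []))) hstep).comp
    (f := fun z : ℕ × List Item => (((), z.1), z.2))
    (((Primrec.const ()).pair Primrec.fst).pair Primrec.snd)).of_eq fun z => ?_
  constructor
  · rintro ⟨Z, h0, hZ, hn⟩
    have : ∀ j ≤ z.1, greedy E j = Z j := by
      intro j
      induction j with
      | zero => exact fun _ => h0.symm
      | succ j ih => exact fun hj => by rw [greedy_succ, ih (by omega)]; exact hZ j hj
    exact (this z.1 le_rfl).trans hn
  · intro h
    exact ⟨greedy E, rfl, fun j _ => rfl, h⟩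

/-! ### The machine that satisfies the accepted requests -/

/-- `p` is a code word reserved for an accepted request for `x`. -/
def greedyGraph (E : ℕ → Request → Prop) (p : List Bool) (_ : Unit) (x : List Bool) : Prop :=
  ∃ v : ℕ × Item × List Item, greedy E v.1 = v.2.1 :: v.2.2 ∧
    v.2.1.1.1 = x ∧ Fits p v.2.1.1.2 (v.2.2.map fun i => i.1.2)

theorem isPrefixFreeGraph_greedyGraph : IsPrefixFreeGraph (greedyGraph E) := by
  have key : ∀ {i j : ℕ} {a b : Item} {L M : List Item} {p q : List Bool}, i ≤ j →
      greedy E i = a :: L → greedy E j = b :: M → Fits p a.1.2 (L.map fun i => i.1.2) →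
      Fits q b.1.2 (M.map fun i => i.1.2) → (p <+: q ∨ q <+: p) → p = q ∧ a.1.1 = b.1.1 := by
    intro i j a b L M p q hij ha hb hp hq hpq
    have hs := greedy_suffix (E := E) hij
    -- Either both words serve the same acceptance and have equal length, or the first item was
    -- accepted strictly earlier and the slots are disjoint.
    rw [ha, hb, List.suffix_cons_iff] at hs
    rcases hs with hs | hs
    · obtain ⟨rfl, rfl⟩ := List.cons.inj hs
      have hl : p.length = q.length := hp.1.trans hq.1.symm
      refine ⟨?_, rfl⟩
      rcases hpq with h | h
      · exact h.eq_of_length hl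
      · exact (h.eq_of_length hl.symm).symm
    · have hw := weight_le_of_suffix (hs.map fun i => i.1.2)
      have := not_comparable_of_fits hp hq hw
      exact absurd hpq (not_or.2 this)
  rintro - p q x y ⟨⟨i, a, L⟩, ha, rfl, hp⟩ ⟨⟨j, b, M⟩, hb, rfl, hq⟩ hpq
  rcases le_total i j with hij | hij
  · exact key hij ha hb hp hq (Or.inl hpq)
  · exact (key hij hb ha hq hp (Or.inr hpq)).imp Eq.symm Eq.symm

theorem isPrefixMachine_greedyGraph (hE : IsSigma1 fun z : ℕ × Request => E z.1 z.2) :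
    IsPrefixMachine {zeroJump} (machineOf (greedyGraph E)) := by
  refine isPrefixMachine_machineOf isPrefixFreeGraph_greedyGraph (recursiveIn_of_isSigma2 ?_)
  have ha : Primrec fun z : ((List Bool × Unit) × List Bool) × (ℕ × Item × List Item) => z.2.2.1 :=
    Primrec.fst.comp (Primrec.snd.comp Primrec.snd)
  have hL : Primrec fun z : ((List Bool × Unit) × List Bool) × (ℕ × Item × List Item) => z.2.2.2 :=
    Primrec.snd.comp (Primrec.snd.comp Primrec.snd)
  refine (IsSigma2.exists'
    (P := fun z : ((List Bool × Unit) × List Bool) × (ℕ × Item × List Item) =>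
      greedy E z.2.1 = z.2.2.1 :: z.2.2.2 ∧ z.2.2.1.1.1 = z.1.2 ∧
        Fits z.1.1.1 z.2.2.1.1.2 (z.2.2.2.map fun i : Item => i.1.2))
    (.and ((isSigma2_greedy hE).comp ((Primrec.fst.comp Primrec.snd).pair
      (Primrec.list_cons.comp ha hL))) (.of_primrecPred (PrimrecPred.and ?_ ?_)))).of_eq
    fun z => (mem_machineOf (G := greedyGraph E) isPrefixFreeGraph_greedyGraph (p := z.1.1) (b := z.1.2)
      (x := z.2)).symm
  · exact Primrec.eq.comp (Primrec.fst.comp (Primrec.fst.comp ha)) (Primrec.snd.comp Primrec.fst)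
  · exact primrecPred_fits.comp ((Primrec.fst.comp (Primrec.fst.comp Primrec.fst)).pair
      ((Primrec.snd.comp (Primrec.fst.comp ha)).pair
        (Primrec.list_map hL (Primrec.snd.comp (Primrec.fst.comp Primrec.snd)).to₂)))

theorem complexity_greedyGraph_le (hE : ∀ n (F : List Request), F.Nodup →
    (∀ f ∈ F, E n f) → weight (F.map Prod.snd) ≤ 2) {x : List Bool} {k N : ℕ}
    (h : ∀ n ≥ N, E n (x, k)) : complexity (machineOf (greedyGraph E)) x () ≤ (k + 2 : ℕ) := by
  obtain ⟨i, M, L, hL⟩ := exists_greedy_eq_cons_of_eventually hE h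
  have hw := weight_le_two_of_not_refused (not_refused_greedy hE i)
  rw [hL, List.map_cons] at hw
  obtain ⟨p, hp⟩ := exists_fits hw
  rw [← hp.1]
  exact complexity_le ((mem_machineOf isPrefixFreeGraph_greedyGraph).2
    ⟨(i, ((x, k), M), L), hL, rfl, hp⟩)

end Greedy

/-! ### The lower bound -/

theorem complexity_le_limsup {U : List Bool → ℕ →. List Bool} {V : List Bool → Unit →. List Bool}
    (hU : IsPrefixMachine ∅ U) (hV : IsOptimalPrefixMachine {zeroJump} V) :
    ∃ c : ℕ, ∀ x, complexity V x () ≤ limsup (fun n : ℕ => complexity U x n) atTop + c := by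
  obtain ⟨c, hc⟩ := exists_code_of_partrec (recursiveIn_empty_iff.1 hU.recursive)
  -- The inequality `K(x|n) ≤ k` can be enumerated, whereas the exact value of `K(x|n)` need not be;
  -- this is why all larger `k` are requested too and the weight bound is 2.
  let E : ℕ → Request → Prop := fun n r => ∃ p, r.1 ∈ U p n ∧ p.length ≤ r.2
  have hE : IsSigma1 fun z : ℕ × Request => E z.1 z.2 := by
    refine (IsSigma1.of_exists (R := fun v : (ℕ × Request) × (List Bool × ℕ) =>
      Code.evaln v.2.2 c (encode (v.2.1, v.1.1)) = some (encode v.1.2.1) ∧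
        v.2.1.length ≤ v.1.2.2) (PrimrecPred.and ?_ ?_)).of_eq fun z => ?_
    · exact Primrec.eq.comp (Code.primrec_evaln.comp (((Primrec.snd.comp Primrec.snd).pair
        (Primrec.const c)).pair (Primrec.encode.comp ((Primrec.fst.comp Primrec.snd).pair
          (Primrec.fst.comp Primrec.fst))))) (Primrec.option_some.comp (Primrec.encode.comp
            (Primrec.fst.comp (Primrec.snd.comp Primrec.fst))))
    · exact Primrec.nat_le.comp (Primrec.list_length.comp (Primrec.fst.comp Primrec.snd))
        (Primrec.snd.comp (Primrec.snd.comp Primrec.fst))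
    · simp only [E, hc (_, _), Code.evaln_complete, Option.mem_def, Prod.exists, exists_and_right]
  have hw : ∀ n (F : List Request), F.Nodup → (∀ f ∈ F, E n f) → weight (F.map Prod.snd) ≤ 2 :=
    fun n F hF h => weight_le_two hU.isPrefixFreeGraph hF h
  obtain ⟨d, hd⟩ := hV.optimal _ (isPrefixMachine_greedyGraph hE)
  -- The 2 is the excess length of the allotted code words, and `d` is the cost of simulating the
  -- greedy machine by `V`.
  refine ⟨2 + d, fun x => ?_⟩
  rcases eq_or_ne (limsup (fun n : ℕ => complexity U x n) atTop) ⊤ with htop | htop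
  · simp [htop]
  obtain ⟨k, hk⟩ := ENat.ne_top_iff_exists.1 htop
  have hlt : limsup (fun n : ℕ => complexity U x n) atTop < ((k + 1 : ℕ) : ℕ∞) := by
    rw [← hk]
    exact_mod_cast Nat.lt_succ_self k
  obtain ⟨N, hN⟩ := eventually_atTop.1 (eventually_lt_of_limsup_lt hlt)
  have hx : ∀ n ≥ N, E n (x, k) := fun n hn => by
    refine exists_program (Order.le_of_lt_add_one ?_)
    exact_mod_cast hN n hn
  rw [← hk]
  refine (hd x ()).trans ?_
  grw [complexity_greedyGraph_le hw hx]
  push_cast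
  rw [add_assoc]

end LimitComplexity

/-- `U` defines the conditional prefix complexity `K(x|n)`; `V`, whose only condition is the
trivial one, defines the relativized unconditional prefix complexity of `x`. -/
theorem theorem3 :
    (∃ U : List Bool → ℕ →. List Bool, LimitComplexity.IsOptimalPrefixMachine ∅ U) ∧
    (∃ V : List Bool → Unit →. List Bool,
      LimitComplexity.IsOptimalPrefixMachine {LimitComplexity.zeroJump} V) ∧
    ∀ (U : List Bool → ℕ →. List Bool) (V : List Bool → Unit →. List Bool),
      LimitComplexity.IsOptimalPrefixMachine ∅ U →
      LimitComplexity.IsOptimalPrefixMachine {LimitComplexity.zeroJump} V →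
      ∃ c : ℕ, ∀ x : List Bool,
        Filter.limsup (fun n : ℕ => LimitComplexity.complexity U x n) Filter.atTop
            ≤ LimitComplexity.complexity V x () + c ∧
        LimitComplexity.complexity V x ()
            ≤ Filter.limsup (fun n : ℕ => LimitComplexity.complexity U x n) Filter.atTop + c := by
  refine ⟨LimitComplexity.exists_isOptimalPrefixMachine_empty,
    LimitComplexity.exists_isOptimalPrefixMachine_zeroJump, fun U V hU hV => ?_⟩
  obtain ⟨c, hc⟩ := LimitComplexity.limsup_complexity_le hU hV.isPrefixMachine
  obtain ⟨d, hd⟩ := LimitComplexity.complexity_le_limsup hU.isPrefixMachine hV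
  refine ⟨max c d, fun x => ⟨(hc x).trans ?_, (hd x).trans ?_⟩⟩ <;> gcongr
  · exact le_max_left c d
  · exact le_max_right c d
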